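/- **Setting.** Let $\theta_1,\theta_2,\theta_3>0$, let $\Lambda=\mathbb{T}^3=(\mathbb{R}/2\pi\mathbb{Z})^3$ with Lebesgue measure, and let $Q(\xi)=\theta_1^2(\xi^1)^2+\theta_2^2(\xi^2)^2+\theta_3^2(\xi^3)^2$ for $\xi\in\mathbb{Z}^3$. The modified Laplacian $\Delta_Q=\sum_{a=1}^{3}\theta_a^2\,\partial_{x^a}^2$ is the Fourier multiplier $-Q(\xi)$. For $\gamma:\Lambda^k\times\Lambda^k\to\mathbb{C}$ in $L^2$ (a density matrix of order $k$) put $$\widehat\gamma(\vec\xi_k;\vec\xi'_k)=\int_{\Lambda^k\times\Lambda^k}\gamma(\vec x_k;\vec x'_k)\,e^{-i\sum_j x_j\cdot\xi_j+i\sum_j x'_j\cdot\xi'_j}\,d\vec x_k\,d\vec x'_k ,\qquad \vec\xi_k,\vec\xi'_k\in(\mathbb{Z}^3)^k .$$ With $\langle\xi\rangle=\sqrt{1+|\xi|^2}$, the operator $S^{(k,\alpha)}$ is the Fourier multiplier $\prod_{j=1}^k\langle\xi_j\rangle^\alpha\prod_{j=1}^k\langle\xi'_j\rangle^\alpha$,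 and $\mathcal{U}_Q^{(k)}(t)\gamma=e^{it\sum_j\Delta_{Q,x_j}}\,\gamma\,e^{-it\sum_j\Delta_{Q,x'_j}}$ is the Fourier multiplier $e^{-it(\sum_jQ(\xi_j)-\sum_jQ(\xi'_j))}$. For $1\le j\le k$ the collision operator is $$B_{j,k+1}\gamma(\vec x_k;\vec x'_k)=\int_\Lambda\big(\delta(x_j-y)-\delta(x'_j-y)\big)\gamma(\vec x_k,y;\vec x'_k,y)\,dy=\gamma(\vec x_k,x_j;\vec x'_k,x_j)-\gamma(\vec x_k,x'_j;\vec x'_k,x'_j),$$ first for trigonometric polynomials $\gamma$ on $\Lambda^{k+1}\times\Lambda^{k+1}$, and then for $\gamma\in L^2(\Lambda^{k+1}\times\Lambda^{k+1})$ as the limit in $L^2(\Lambda^k\times\Lambda^k)$, when it exists, of $B_{j,k+1}$ applied to the partial sums of the Fourier series of $\gamma$ over finite sets $F$ of frequencies (limit along the directed family of finite sets $F$). **Proposition 4.1.** Let $\alpha>1$ be given. There exists $C>0$, which depends only on $\alpha,\theta_1,\theta_2,\theta_3$, such that for all $k\in\mathbb{N}$, all $j\in\{1,\dots,k\}$, and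 all $\gamma_0^{(k+1)}\in L^2(\Lambda^{k+1}\times\Lambda^{k+1})$ with $S^{(k+1,\alpha)}\gamma_0^{(k+1)}\in L^2(\Lambda^{k+1}\times\Lambda^{k+1})$, the function $S^{(k,\alpha)}B_{j,k+1}\,\mathcal{U}_Q^{(k+1)}(t)\,\gamma_0^{(k+1)}$ is well defined in $L^2(\Lambda^k\times\Lambda^k)$ for almost every $t\in[0,1]$, is given by an element of $L^2([0,1]\times\Lambda^k\times\Lambda^k)$, and satisfies $$\big\|S^{(k,\alpha)}B_{j,k+1}\,\mathcal{U}_Q^{(k+1)}(t)\,\gamma_0^{(k+1)}\big\|_{L^2([0,1]\times\Lambda^k\times\Lambda^k)}\le C\,\big\|S^{(k+1,\alpha)}\gamma_0^{(k+1)}\big\|_{L^2(\Lambda^{k+1}\times\Lambda^{k+1})}.$$ -/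

import Mathlib

open MeasureTheory Filter Topology
open scoped ENNReal Real

namespace GrossPitaevskii

instance twoPiPos : Fact (0 < 2 * π) := ⟨Real.two_pi_pos⟩

/-- The classical torus `Λ = 𝕋^d = (ℝ / 2πℤ)^d`, with Lebesgue measure (total mass `(2π)^d`). -/
abbrev Torus (d : ℕ) : Type := Fin d → AddCircle (2 * π)

/-- The space `Λ^k × Λ^k`; its points are pairs `(x₁, …, x_k; x'₁, …, x'_k)`. -/
abbrev Config (d k : ℕ) : Type := (Fin k → Torus d) × (Fin k → Torus d)

/-- The dual lattice `(ℤ^d)^k × (ℤ^d)^k`, with points `(ξ₁, …, ξ_k; ξ'₁, …, ξ'_k)`. -/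
abbrev Freq (d k : ℕ) : Type := (Fin k → Fin d → ℤ) × (Fin k → Fin d → ℤ)

/-- The exponential `exp (i ∑ⱼ xⱼ · ξⱼ - i ∑ⱼ x'ⱼ · ξ'ⱼ)` on `Λ^k × Λ^k`
(here `fourier n y = exp (i n y)` on `ℝ / 2πℤ`). -/
noncomputable def character {d k : ℕ} (ξ : Freq d k) (x : Config d k) : ℂ :=
  (∏ j, ∏ a, fourier (ξ.1 j a) (x.1 j a)) * ∏ j, ∏ a, fourier (-(ξ.2 j a)) (x.2 j a)

/-- The Fourier transform of a density matrix of order `k`,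
`γ̂(ξ; ξ') = ∫ γ(x; x') exp (-i ∑ⱼ xⱼ · ξⱼ + i ∑ⱼ x'ⱼ · ξ'ⱼ) dx dx'`. -/
noncomputable def fourierTransform {d k : ℕ} (γ : Config d k → ℂ) (ξ : Freq d k) : ℂ :=
  ∫ x, γ x * (starRingEnd ℂ) (character ξ x)

/-- `g = m(D) γ`: both are in `L²(Λ^k × Λ^k)`, and `ĝ = m γ̂`. Given `γ`, the function `g` is
determined up to a null set. -/
def IsMultiplier {d k : ℕ} (m : Freq d k → ℂ) (γ g : Config d k → ℂ) : Prop :=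
  MemLp γ 2 volume ∧ MemLp g 2 volume ∧
    ∀ ξ : Freq d k, fourierTransform g ξ = m ξ * fourierTransform γ ξ

/-- The Japanese bracket `⟨ξ⟩ = √(1 + |ξ|²)`. -/
noncomputable def japaneseBracket {d : ℕ} (ξ : Fin d → ℤ) : ℝ :=
  √(1 + ∑ a, (ξ a : ℝ) ^ 2)

/-- `g = S^{(k,α)} γ`, the fractional differentiation operator with Fourier multiplier
`∏ⱼ ⟨ξⱼ⟩^α ∏ⱼ ⟨ξ'ⱼ⟩^α`. -/
def IsFracDeriv {d k : ℕ} (α : ℝ) (γ g : Config d k → ℂ) : Prop :=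
  IsMultiplier
    (fun ξ => (((∏ j, japaneseBracket (ξ.1 j) ^ α) * ∏ j, japaneseBracket (ξ.2 j) ^ α : ℝ) : ℂ))
    γ g

/-- The quadratic form `Q(ξ) = ∑ₐ θₐ² ξₐ²` on `ℤ^d`; the modified Laplacian `Δ_Q` is the Fourier
multiplier `-Q`. -/
noncomputable def quadForm {d : ℕ} (θ : Fin d → ℝ) (ξ : Fin d → ℤ) : ℝ :=
  ∑ a, θ a ^ 2 * (ξ a : ℝ) ^ 2

/-- `g = 𝒰_Q^{(k)}(t) γ = e^{it ∑ⱼ Δ_{Q,xⱼ}} γ e^{-it ∑ⱼ Δ_{Q,x'ⱼ}}`; on kernels this is the Fourier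
multiplier `exp (-it (∑ⱼ Q(ξⱼ) - ∑ⱼ Q(ξ'ⱼ)))`. -/
def IsFreeEvolution {d k : ℕ} (θ : Fin d → ℝ) (t : ℝ) (γ g : Config d k → ℂ) : Prop :=
  IsMultiplier
    (fun ξ => Complex.exp (-Complex.I * (t : ℂ) *
      ((∑ j, quadForm θ (ξ.1 j) - ∑ j, quadForm θ (ξ.2 j) : ℝ) : ℂ)))
    γ g

/-- The collision operator `B_{j,k+1} = B⁺_{j,k+1} - B⁻_{j,k+1}` on kernels with well-defined
pointwise values: integrating `γ(x, y; x', y)` in `y` against `δ(xⱼ - y) - δ(x'ⱼ - y)` gives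
`γ(x, xⱼ; x', xⱼ) - γ(x, x'ⱼ; x', x'ⱼ)`. -/
def collision {d k : ℕ} (j : Fin k) (γ : Config d (k + 1) → ℂ) (x : Config d k) : ℂ :=
  γ (Fin.snoc (α := fun _ => Torus d) x.1 (x.1 j), Fin.snoc (α := fun _ => Torus d) x.2 (x.1 j)) -
  γ (Fin.snoc (α := fun _ => Torus d) x.1 (x.2 j), Fin.snoc (α := fun _ => Torus d) x.2 (x.2 j))

/-- The partial sum of the Fourier series of `γ` over a finite set `F` of frequencies. -/
noncomputable def partialSum {d k : ℕ} (F : Finset (Freq d k)) (γ : Config d k → ℂ)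
    (x : Config d k) : ℂ :=
  (((2 * π) ^ (2 * d * k) : ℝ) : ℂ)⁻¹ * ∑ ξ ∈ F, fourierTransform γ ξ * character ξ x

/-- `b = B_{j,k+1} γ` for `γ ∈ L²(Λ^{k+1} × Λ^{k+1})`. The operator restricts `γ` to null sets, so it
is read as a trace: the collision operator is applied to the trigonometric polynomials that are the
partial sums of the Fourier series of `γ`, and `b` is the (unconditional) limit in
`L²(Λ^k × Λ^k)`. -/
def IsCollision {d k : ℕ} (j : Fin k) (γ : Config d (k + 1) → ℂ) (b : Config d k → ℂ) : Prop :=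
  MemLp γ 2 volume ∧ MemLp b 2 volume ∧
    Tendsto (fun F : Finset (Freq d (k + 1)) =>
      eLpNorm (fun x => collision j (partialSum F γ) x - b x) 2 volume) atTop (𝓝 0)

/-- Lebesgue measure on `[0,1] × Λ^k × Λ^k`. -/
noncomputable def spacetimeMeasure (d k : ℕ) : Measure (ℝ × Config d k) :=
  (volume.restrict (Set.Icc (0 : ℝ) 1)).prod volume

end GrossPitaevskii

/-! On the Fourier side, the collision operator `B⁺_{j,k+1}` sends the character with frequency
`ξ` to the one whose `j`-th entry is `ξⱼ + ξ_{k+1} - ξ'_{k+1}` (`collision_character`, with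
`gainFreq`), and `B⁻` is its conjugate (`lossFreq`). Hence the Fourier coefficient of
`B⁺ 𝒰(t) γ₀` at a frequency `η` is a sum over a fiber of this map, parametrised by the triples
`n₁ + n₂ - n₃ = n` with `n = ηⱼ`, of `γ̂₀` times a phase with time frequency
`Q(n₁) + Q(n₂) - Q(n₃)` up to a constant; all the other particles are spectators.

Over a unit time interval, phases whose frequencies differ by much more than `1` are almost
orthogonal. So the square of the `L²([0,1])` norm of such a sum is bounded by the weighted sum of
squares of its coefficients, as soon as the weights in every frequency window of bounded length
have a bounded sum (`lintegral_enorm_sq_exp_sum_le`). This reduces the theorem to the lattice point bound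
`exists_tsum_resonance_le`: the sum of
`⟨n⟩^{2α} ⟨n₁⟩^{-2α} ⟨n₂⟩^{-2α} ⟨n₃⟩^{-2α}` over all `n₁ + n₂ - n₃ = n` with
`Q(n₁) + Q(n₂) - Q(n₃) = μ + O(1)` is bounded uniformly in `n` and `μ`.

The resonance condition says that `∑ₐ θₐ² pₐ qₐ` lies in a window of bounded length, where
`p = n₁ - n` and `q = n₂ - n`. The bracket `⟨n⟩` is absorbed by the largest of the `⟨nᵢ⟩`, and the
remaining weights in two of the variables are distributed over the coordinates: an exponent
`β > 1` is given to two coordinates of each variable and a small exponent `δ > 0` to the third,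
where `2β + δ = 2α`; here `α > 1` is used. If `pₐ qₐ ≠ 0` for some `a`, all the other coordinates
are summed by means of `β`, and for the `a`-th ones there remain boundedly many hyperbolas
`pₐ qₐ = m ≠ 0` in `ℤ²`. A hyperbola has `O(M ^ κ)` lattice points in any box of side `M`,
wherever the box lies: three of them span a triangle of area at least `1/2`, which is only possible
for `|m| ≤ M ^ 6`, and then the divisor bound applies (`exists_card_hyperbola_le`). If all the products
`pₐ qₐ` vanish but `p` and `q` do not, there are just three free coordinates, at most two of them
in the same variable. The cases `p = 0` and `q = 0` are summed directly. The quadratic form need not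
be rational: each `θₐ²` only enters through the number of integers `m` in a window.

The trace itself converges in `L²` for every time, since `⟨·⟩^{-2α}` lies in `ℓ^{3/2}(ℤ³)`
(`exists_tsum_trace_le`). Together the two bounds make the series defining `B 𝒰(t) γ₀` and
`S B 𝒰 γ₀` converge unconditionally in `L²(Λ^k × Λ^k)` and in `L²([0,1] × Λ^k × Λ^k)`
(`exists_tendsto_eLpNorm_sum_sub`), and Fatou's lemma identifies the Fourier coefficients of almost
every time slice of the second limit (`ae_fourierTransform_slice_eq`). Only the orthogonality of the
characters is needed, not their completeness. -/

namespace GrossPitaevskii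

/-! ### Lattice points on hyperbolas -/

/-- The divisor bound `d(n) = O(n ^ ε)`. -/
theorem exists_card_divisors_le {ε : ℝ} (hε : 0 < ε) :
    ∃ C : ℝ, 1 ≤ C ∧ ∀ n : ℕ, n ≠ 0 → (n.divisors.card : ℝ) ≤ C * (n : ℝ) ^ ε := by
  have hL : 0 < ε * Real.log 2 := mul_pos hε (Real.log_pos (by norm_num))
  set K : ℝ := 1 + 1 / (ε * Real.log 2) with hK
  have hK1 : 1 ≤ K := by
    have : 0 < 1 / (ε * Real.log 2) := by positivity
    linarith
  obtain ⟨P, hP⟩ := exists_nat_ge ((2 : ℝ) ^ (1 / ε))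
  have hsmall : ∀ p e : ℕ, 2 ≤ p → (e + 1 : ℝ) ≤ K * ((p : ℝ) ^ e) ^ ε := by
    intro p e hp
    have hp' : (2 : ℝ) ≤ p := by exact_mod_cast hp
    have h1 : ((2 : ℝ) ^ e) ^ ε ≤ ((p : ℝ) ^ e) ^ ε := by gcongr
    have h2 : 1 + e * (ε * Real.log 2) ≤ ((2 : ℝ) ^ e) ^ ε := by
      rw [← Real.rpow_natCast, ← Real.rpow_mul (by norm_num), Real.rpow_def_of_pos (by norm_num)]
      have := Real.add_one_le_exp (Real.log 2 * (e * ε))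
      linarith
    have h3 : (e + 1 : ℝ) ≤ K * (1 + e * (ε * Real.log 2)) := by
      have : K * (1 + e * (ε * Real.log 2))
          = 1 + e * (ε * Real.log 2) + 1 / (ε * Real.log 2) + e := by
        rw [hK]; field_simp; ring
      rw [this]
      have h4 : 0 ≤ e * (ε * Real.log 2) := by positivity
      have h5 : 0 < 1 / (ε * Real.log 2) := by positivity
      linarith
    exact h3.trans (mul_le_mul_of_nonneg_left (h2.trans h1) (by linarith))
  have hlarge : ∀ p e : ℕ, P ≤ p → (e + 1 : ℝ) ≤ ((p : ℝ) ^ e) ^ ε := by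
    intro p e hp
    have hp' : (2 : ℝ) ^ (1 / ε) ≤ p := hP.trans (by exact_mod_cast hp)
    have h1 : (2 : ℝ) ≤ (p : ℝ) ^ ε := by
      calc (2 : ℝ) = ((2 : ℝ) ^ (1 / ε)) ^ ε := by
            rw [← Real.rpow_mul (by norm_num), one_div_mul_cancel hε.ne', Real.rpow_one]
        _ ≤ (p : ℝ) ^ ε := by gcongr
    have h2 : ((p : ℝ) ^ e) ^ ε = ((p : ℝ) ^ ε) ^ e := by
      rw [← Real.rpow_natCast, ← Real.rpow_natCast, ← Real.rpow_mul (by positivity),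
        ← Real.rpow_mul (by positivity), mul_comm]
    rw [h2]
    have h3 : (e + 1 : ℝ) ≤ 2 ^ e := by exact_mod_cast Nat.lt_two_pow_self (n := e)
    exact h3.trans (by gcongr)
  refine ⟨K ^ P, one_le_pow₀ hK1, fun n hn => ?_⟩
  have hn' : (n : ℝ) ^ ε = ∏ p ∈ n.primeFactors, ((p : ℝ) ^ n.factorization p) ^ ε := by
    rw [Real.finsetProd_rpow _ _ (fun i _ => by positivity)]
    congr 1
    conv_lhs => rw [← Nat.prod_factorization_pow_eq_self hn]
    simp [Finsupp.prod]
  rw [Nat.card_divisors hn, hn']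
  push_cast
  calc ∏ p ∈ n.primeFactors, ((n.factorization p : ℝ) + 1)
      ≤ ∏ p ∈ n.primeFactors, ((if p < P then K else 1) * ((p : ℝ) ^ n.factorization p) ^ ε) := by
        refine Finset.prod_le_prod (fun i _ => by positivity) fun p hp => ?_
        split_ifs with h
        · exact hsmall p _ (Nat.prime_of_mem_primeFactors hp).two_le
        · rw [one_mul]; exact hlarge p _ (not_lt.1 h)
    _ = (∏ p ∈ n.primeFactors, (if p < P then K else 1)) *
          ∏ p ∈ n.primeFactors, ((p : ℝ) ^ n.factorization p) ^ ε := Finset.prod_mul_distrib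
    _ ≤ _ := by
        refine mul_le_mul_of_nonneg_right ?_
          (Finset.prod_nonneg fun i _ => by positivity)
        rw [← Finset.prod_filter, Finset.prod_const]
        refine pow_le_pow_right₀ hK1 ?_
        calc (n.primeFactors.filter (· < P)).card ≤ (Finset.range P).card :=
              Finset.card_le_card fun x hx => by simpa using (Finset.mem_filter.1 hx).2
          _ = P := Finset.card_range P

/-- Three distinct lattice points on the hyperbola `p q = m ≠ 0` lie in a box of side at least
`|m| ^ (1/6)`. Indeed the area of the triangle which they span is half of a nonzero integer `D`,
whereas `D p₁ p₂ p₃ = m (p₂ - p₁) (p₃ - p₁) (p₃ - p₂)`, and likewise for the other coordinate. -/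
theorem natAbs_le_of_three_points {m p₁ q₁ p₂ q₂ p₃ q₃ : ℤ} {M : ℕ} (hm : m ≠ 0)
    (h₁ : p₁ * q₁ = m) (h₂ : p₂ * q₂ = m) (h₃ : p₃ * q₃ = m)
    (h₁₂ : p₁ ≠ p₂) (h₁₃ : p₁ ≠ p₃) (h₂₃ : p₂ ≠ p₃)
    (a₁ : |p₂ - p₁| ≤ M) (a₂ : |p₃ - p₁| ≤ M) (a₃ : |p₃ - p₂| ≤ M)
    (b₁ : |q₂ - q₁| ≤ M) (b₂ : |q₃ - q₁| ≤ M) (b₃ : |q₃ - q₂| ≤ M) :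
    m.natAbs ≤ M ^ 6 := by
  set D : ℤ := (p₂ - p₁) * (q₃ - q₁) - (p₃ - p₁) * (q₂ - q₁) with hD
  have hp : D * (p₁ * p₂ * p₃) = m * ((p₂ - p₁) * (p₃ - p₁) * (p₃ - p₂)) := by
    have e1 : p₁ * p₂ * p₃ * q₁ = p₂ * p₃ * m := by rw [← h₁]; ring
    have e2 : p₁ * p₂ * p₃ * q₂ = p₁ * p₃ * m := by rw [← h₂]; ring
    have e3 : p₁ * p₂ * p₃ * q₃ = p₁ * p₂ * m := by rw [← h₃]; ring
    rw [hD]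
    linear_combination (p₂ - p₁) * (e3 - e1) - (p₃ - p₁) * (e2 - e1)
  have hq : D * (q₁ * q₂ * q₃) = -(m * ((q₂ - q₁) * (q₃ - q₁) * (q₃ - q₂))) := by
    have e1 : q₁ * q₂ * q₃ * p₁ = q₂ * q₃ * m := by rw [← h₁]; ring
    have e2 : q₁ * q₂ * q₃ * p₂ = q₁ * q₃ * m := by rw [← h₂]; ring
    have e3 : q₁ * q₂ * q₃ * p₃ = q₁ * q₂ * m := by rw [← h₃]; ring
    rw [hD]
    linear_combination (q₃ - q₁) * (e2 - e1) - (q₂ - q₁) * (e3 - e1)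
  have hD0 : D ≠ 0 := by
    intro h
    rw [h, zero_mul] at hp
    have : m * ((p₂ - p₁) * (p₃ - p₁) * (p₃ - p₂)) ≠ 0 :=
      mul_ne_zero hm (mul_ne_zero (mul_ne_zero (sub_ne_zero.2 h₁₂.symm) (sub_ne_zero.2 h₁₃.symm))
        (sub_ne_zero.2 h₂₃.symm))
    exact this hp.symm
  have hD1 : 1 ≤ |D| := Int.one_le_abs hD0
  have hM : (0 : ℤ) ≤ M := Int.natCast_nonneg M
  have hm' : 0 < |m| := abs_pos.2 hm
  have hp' : |p₁ * p₂ * p₃| ≤ |m| * M ^ 3 := by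
    calc |p₁ * p₂ * p₃| ≤ |D| * |p₁ * p₂ * p₃| := le_mul_of_one_le_left (abs_nonneg _) hD1
      _ = |m| * (|p₂ - p₁| * |p₃ - p₁| * |p₃ - p₂|) := by
        rw [← abs_mul, hp, abs_mul, abs_mul, abs_mul]
      _ ≤ |m| * (M * M * M) := by gcongr
      _ = _ := by ring
  have hq' : |q₁ * q₂ * q₃| ≤ |m| * M ^ 3 := by
    calc |q₁ * q₂ * q₃| ≤ |D| * |q₁ * q₂ * q₃| := le_mul_of_one_le_left (abs_nonneg _) hD1
      _ = |m| * (|q₂ - q₁| * |q₃ - q₁| * |q₃ - q₂|) := by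
        rw [← abs_mul, hq, abs_neg, abs_mul, abs_mul, abs_mul]
      _ ≤ |m| * (M * M * M) := by gcongr
      _ = _ := by ring
  have hprod : |m| ^ 3 ≤ |m| ^ 2 * M ^ 6 := by
    calc |m| ^ 3 = |p₁ * p₂ * p₃| * |q₁ * q₂ * q₃| := by
          rw [← abs_mul, ← abs_pow]; congr 1
          calc m ^ 3 = (p₁ * q₁) * (p₂ * q₂) * (p₃ * q₃) := by rw [h₁, h₂, h₃]; ring
            _ = _ := by ring
      _ ≤ (|m| * M ^ 3) * (|m| * M ^ 3) :=
          mul_le_mul hp' hq' (abs_nonneg _) (by positivity)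
      _ = _ := by ring
  have hfin : |m| ≤ (M : ℤ) ^ 6 := by
    have : |m| ^ 2 * |m| ≤ |m| ^ 2 * M ^ 6 := by rw [← pow_succ]; exact hprod
    exact le_of_mul_le_mul_left this (by positivity)
  rw [Int.abs_eq_natAbs] at hfin
  exact_mod_cast hfin

/-- A hyperbola `p q = m ≠ 0` has `O(M ^ κ)` lattice points in a box of side `M`, wherever the
box is placed. -/
theorem exists_card_hyperbola_le {κ : ℝ} (hκ : 0 < κ) :
    ∃ C : ℝ, 0 < C ∧ ∀ (m : ℤ) (M : ℕ) (s : Finset (ℤ × ℤ)), m ≠ 0 → 1 ≤ M →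
      (∀ z ∈ s, z.1 * z.2 = m) →
      (∀ z ∈ s, ∀ w ∈ s, |z.1 - w.1| ≤ M ∧ |z.2 - w.2| ≤ M) →
      (s.card : ℝ) ≤ C * (M : ℝ) ^ κ := by
  obtain ⟨C, hC1, hC⟩ := exists_card_divisors_le (ε := κ / 6) (by positivity)
  refine ⟨2 * C, by linarith, fun m M s hm hM hs hbox => ?_⟩
  have hM' : (1 : ℝ) ≤ M := by exact_mod_cast hM
  have hMk : 1 ≤ (M : ℝ) ^ κ := Real.one_le_rpow hM' hκ.le
  have hinj : ∀ z ∈ s, ∀ w ∈ s, z.1 = w.1 → z = w := by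
    intro z hz w hw h
    refine Prod.ext h ?_
    have h1 := hs z hz
    have h2 := hs w hw
    have h0 : z.1 ≠ 0 := by rintro h0; rw [h0, zero_mul] at h1; exact hm h1.symm
    rw [← h] at h2
    exact mul_left_cancel₀ h0 (h1.trans h2.symm)
  by_cases h3 : s.card ≤ 2
  · have : (s.card : ℝ) ≤ 2 := by exact_mod_cast h3
    nlinarith
  · obtain ⟨z₁, hz₁, z₂, hz₂, z₃, hz₃, h12, h13, h23⟩ := Finset.two_lt_card.1 (not_le.1 h3)
    have hmM : m.natAbs ≤ M ^ 6 :=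
      natAbs_le_of_three_points hm (hs _ hz₁) (hs _ hz₂) (hs _ hz₃)
        (fun h => h12 (hinj _ hz₁ _ hz₂ h)) (fun h => h13 (hinj _ hz₁ _ hz₃ h))
        (fun h => h23 (hinj _ hz₂ _ hz₃ h))
        (hbox _ hz₂ _ hz₁).1 (hbox _ hz₃ _ hz₁).1 (hbox _ hz₃ _ hz₂).1
        (hbox _ hz₂ _ hz₁).2 (hbox _ hz₃ _ hz₁).2 (hbox _ hz₃ _ hz₂).2
    have hcard : s.card ≤ 2 * m.natAbs.divisors.card := by
      have hsub : s.image Prod.fst ⊆ m.natAbs.divisors.image (fun n : ℕ => (n : ℤ)) ∪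
          m.natAbs.divisors.image (fun n : ℕ => -(n : ℤ)) := by
        intro p hp
        obtain ⟨z, hz, rfl⟩ := Finset.mem_image.1 hp
        have hd : z.1.natAbs ∈ m.natAbs.divisors := by
          rw [Nat.mem_divisors]
          refine ⟨?_, by simpa using hm⟩
          rw [Int.natAbs_dvd_natAbs]
          exact Dvd.intro _ (hs z hz)
        rw [Finset.mem_union, Finset.mem_image, Finset.mem_image]
        rcases Int.natAbs_eq z.1 with h | h
        · exact Or.inl ⟨_, hd, h.symm⟩
        · exact Or.inr ⟨_, hd, h.symm⟩
      calc s.card = (s.image Prod.fst).card :=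
            (Finset.card_image_of_injOn fun z hz w hw h => hinj z hz w hw h).symm
        _ ≤ _ := Finset.card_le_card hsub
        _ ≤ _ := Finset.card_union_le _ _
        _ ≤ m.natAbs.divisors.card + m.natAbs.divisors.card :=
            Nat.add_le_add Finset.card_image_le Finset.card_image_le
        _ = _ := by ring
    calc (s.card : ℝ) ≤ 2 * m.natAbs.divisors.card := by exact_mod_cast hcard
      _ ≤ 2 * (C * (m.natAbs : ℝ) ^ (κ / 6)) := by
          have := hC m.natAbs (by simpa using hm); linarith
      _ ≤ 2 * (C * ((M : ℝ) ^ 6) ^ (κ / 6)) := by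
          have : (m.natAbs : ℝ) ≤ (M : ℝ) ^ 6 := by exact_mod_cast hmM
          gcongr
      _ = _ := by
          rw [← Real.rpow_natCast, ← Real.rpow_mul (by positivity)]
          norm_num
          rw [mul_div_cancel₀ _ (by norm_num : (6 : ℝ) ≠ 0)]
          ring

/-- The bracket `⟨t⟩ = √(1 + t²)` of an integer. -/
noncomputable def intBracket (t : ℤ) : ℝ := √(1 + (t : ℝ) ^ 2)

theorem one_le_intBracket (t : ℤ) : 1 ≤ intBracket t :=
  Real.one_le_sqrt.2 (by nlinarith [sq_nonneg (t : ℝ)])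

theorem intBracket_pos (t : ℤ) : 0 < intBracket t := one_pos.trans_le (one_le_intBracket t)

theorem abs_add_one_le_intBracket (t : ℤ) : |(t : ℝ)| + 1 ≤ 2 * intBracket t := by
  have h1 : |(t : ℝ)| ≤ intBracket t := Real.abs_le_sqrt (by linarith)
  linarith [one_le_intBracket t]

theorem intBracket_rpow_neg_le_one (t : ℤ) {δ : ℝ} (hδ : 0 ≤ δ) : intBracket t ^ (-δ) ≤ 1 :=
  Real.rpow_le_one_of_one_le_of_nonpos (one_le_intBracket t) (by linarith)

theorem summable_intBracket_rpow_neg {β : ℝ} (hβ : 1 < β) :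
    Summable fun t : ℤ => intBracket t ^ (-β) := by
  have h : Summable fun t : ℤ => 2 ^ β * |(t : ℝ)| ^ (-β) :=
    (Real.summable_abs_int_rpow hβ).mul_left _
  refine h.of_norm_bounded_eventually ?_
  rw [Filter.eventually_cofinite]
  refine (Set.finite_singleton (0 : ℤ)).subset fun t ht => ?_
  by_contra h0
  apply ht
  have ht0 : 0 < |(t : ℝ)| := abs_pos.2 (by exact_mod_cast h0)
  rw [Real.norm_of_nonneg (Real.rpow_nonneg (intBracket_pos t).le _)]
  have h2 : |(t : ℝ)| / 2 ≤ intBracket t := by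
    linarith [abs_add_one_le_intBracket t]
  calc intBracket t ^ (-β) ≤ (|(t : ℝ)| / 2) ^ (-β) :=
        Real.rpow_le_rpow_of_nonpos (by positivity) h2 (by linarith)
    _ = 2 ^ β * |(t : ℝ)| ^ (-β) := by
        rw [Real.div_rpow ht0.le (by norm_num), Real.rpow_neg (by norm_num : (0 : ℝ) ≤ 2)]
        field_simp

theorem tsum_intBracket_rpow_neg_ne_top {β : ℝ} (hβ : 1 < β) :
    ∑' t : ℤ, ENNReal.ofReal (intBracket t ^ (-β)) ≠ ⊤ := by
  rw [← ENNReal.ofReal_tsum_of_nonneg (fun t => Real.rpow_nonneg (intBracket_pos t).le _)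
    (summable_intBracket_rpow_neg hβ)]
  exact ENNReal.ofReal_ne_top

/-! ### Weighted sums over hyperbolic strips -/

/-- The sum over the lattice points of a hyperbola of a weight with an arbitrarily small power
decay is bounded, uniformly in the position of the hyperbola. -/
theorem exists_tsum_hyperbola_le {δ : ℝ} (hδ : 0 < δ) :
    ∃ C : ℝ≥0∞, C ≠ ⊤ ∧ ∀ m c d σ : ℤ, m ≠ 0 → |σ| ≤ 1 →
      ∑' z : ℤ × ℤ, (if (z.1 - c) * (z.2 - σ * z.1 - d) = m then
        ENNReal.ofReal (intBracket z.1 ^ (-δ) * intBracket z.2 ^ (-δ)) else 0) ≤ C := by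
  obtain ⟨C, hC0, hC⟩ := exists_card_hyperbola_le (κ := δ / 2) (by positivity)
  set r : ℝ := 2 ^ (-(δ / 2)) with hr
  have hr0 : 0 < r := by positivity
  have hr1 : r < 1 := Real.rpow_lt_one_of_one_lt_of_neg (by norm_num) (by linarith)
  set A : ℝ := 2 ^ δ * C * 8 ^ (δ / 2) with hA
  have hA0 : 0 < A := by positivity
  refine ⟨∑' i : ℕ, ENNReal.ofReal (A * r ^ i), ?_, fun m c d σ hm hσ => ?_⟩
  · rw [← ENNReal.ofReal_tsum_of_nonneg (fun i => by positivity)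
      ((summable_geometric_of_lt_one hr0.le hr1).mul_left A)]
    exact ENNReal.ofReal_ne_top
  -- The size of a point, and the dyadic decomposition according to it.
  let sz : ℤ × ℤ → ℕ := fun z => max z.1.natAbs z.2.natAbs + 1
  have hsz : ∀ z : ℤ × ℤ, intBracket z.1 ^ (-δ) * intBracket z.2 ^ (-δ)
      ≤ 2 ^ δ * (sz z : ℝ) ^ (-δ) := by
    intro z
    have key : ∀ t : ℤ, intBracket t ^ (-δ) ≤ 2 ^ δ * ((t.natAbs : ℝ) + 1) ^ (-δ) := by
      intro t
      have h2 : ((t.natAbs : ℝ) + 1) / 2 ≤ intBracket t := by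
        have := abs_add_one_le_intBracket t
        rw [Nat.cast_natAbs, Int.cast_abs]; linarith
      calc intBracket t ^ (-δ) ≤ (((t.natAbs : ℝ) + 1) / 2) ^ (-δ) :=
            Real.rpow_le_rpow_of_nonpos (by positivity) h2 (by linarith)
        _ = _ := by
            rw [Real.div_rpow (by positivity) (by norm_num),
              Real.rpow_neg (by norm_num : (0 : ℝ) ≤ 2)]
            field_simp
    have p1 : 0 ≤ intBracket z.1 ^ (-δ) := Real.rpow_nonneg (intBracket_pos _).le _
    have p2 : 0 ≤ intBracket z.2 ^ (-δ) := Real.rpow_nonneg (intBracket_pos _).le _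
    rcases le_total z.1.natAbs z.2.natAbs with h | h
    · have : sz z = z.2.natAbs + 1 := by simp only [sz, max_eq_right h]
      rw [this]; push_cast
      exact (mul_le_of_le_one_left p2 (intBracket_rpow_neg_le_one _ hδ.le)).trans (key _)
    · have : sz z = z.1.natAbs + 1 := by simp only [sz, max_eq_left h]
      rw [this]; push_cast
      exact (mul_le_of_le_one_right p1 (intBracket_rpow_neg_le_one _ hδ.le)).trans (key _)
  let H : ℤ × ℤ → Prop := fun z => (z.1 - c) * (z.2 - σ * z.1 - d) = m
  have hdyadic : ∀ z : ℤ × ℤ, (if H z then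
      ENNReal.ofReal (intBracket z.1 ^ (-δ) * intBracket z.2 ^ (-δ)) else 0) ≤
      ∑' i : ℕ, if H z ∧ sz z < 2 ^ (i + 1) then
        ENNReal.ofReal (2 ^ δ * ((2 : ℝ) ^ i) ^ (-δ)) else 0 := by
    intro z
    by_cases hz : H z
    · have h1 : 2 ^ Nat.log 2 (sz z) ≤ sz z := Nat.pow_log_le_self 2 (Nat.succ_ne_zero _)
      have h2 : sz z < 2 ^ (Nat.log 2 (sz z) + 1) := Nat.lt_pow_succ_log_self (by norm_num) _
      refine le_trans ?_ (ENNReal.le_tsum (Nat.log 2 (sz z)))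
      rw [if_pos hz, if_pos ⟨hz, h2⟩]
      refine ENNReal.ofReal_le_ofReal ((hsz z).trans ?_)
      have h3 : (2 : ℝ) ^ Nat.log 2 (sz z) ≤ sz z := by exact_mod_cast h1
      exact mul_le_mul_of_nonneg_left
        (Real.rpow_le_rpow_of_nonpos (by positivity) h3 (by linarith)) (by positivity)
    · rw [if_neg hz]; exact zero_le
  calc _ ≤ ∑' z : ℤ × ℤ, ∑' i : ℕ, (if H z ∧ sz z < 2 ^ (i + 1) then
        ENNReal.ofReal (2 ^ δ * ((2 : ℝ) ^ i) ^ (-δ)) else 0) := ENNReal.tsum_le_tsum hdyadic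
    _ = ∑' i : ℕ, ∑' z : ℤ × ℤ, (if H z ∧ sz z < 2 ^ (i + 1) then
        ENNReal.ofReal (2 ^ δ * ((2 : ℝ) ^ i) ^ (-δ)) else 0) := ENNReal.tsum_comm
    _ ≤ _ := by
      refine ENNReal.tsum_le_tsum fun i => ?_
      rw [ENNReal.tsum_eq_iSup_sum]
      refine iSup_le fun s => ?_
      rw [← Finset.sum_filter, Finset.sum_const, nsmul_eq_mul]
      set t := s.filter fun z => H z ∧ sz z < 2 ^ (i + 1) with ht
      have hcard : (t.card : ℝ) ≤ C * ((8 * 2 ^ i : ℕ) : ℝ) ^ (δ / 2) := by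
        let φ : ℤ × ℤ → ℤ × ℤ := fun z => (z.1 - c, z.2 - σ * z.1 - d)
        have hφ : Function.Injective φ := by
          rintro ⟨x, y⟩ ⟨x', y'⟩ h
          simp only [φ, Prod.mk.injEq] at h
          have hx : x = x' := by linarith [h.1]
          subst hx
          exact Prod.ext rfl (by simpa using h.2)
        rw [← Finset.card_image_of_injective t hφ]
        refine hC m (8 * 2 ^ i) (t.image φ) hm ?_ ?_ ?_
        · have : 1 ≤ 2 ^ i := Nat.one_le_two_pow
          omega
        · intro w hw
          obtain ⟨z, hz, rfl⟩ := Finset.mem_image.1 hw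
          exact (Finset.mem_filter.1 hz).2.1
        · have hb : ∀ z ∈ t, |z.1| ≤ 2 * 2 ^ i ∧ |z.2| ≤ 2 * 2 ^ i := by
            intro z hz
            have h := (Finset.mem_filter.1 hz).2.2
            have h1 : z.1.natAbs ≤ 2 * 2 ^ i := by
              have := le_max_left z.1.natAbs z.2.natAbs
              simp only [sz, pow_succ] at h; omega
            have h2 : z.2.natAbs ≤ 2 * 2 ^ i := by
              have := le_max_right z.1.natAbs z.2.natAbs
              simp only [sz, pow_succ] at h; omega
            rw [Int.abs_eq_natAbs, Int.abs_eq_natAbs]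
            exact ⟨by exact_mod_cast h1, by exact_mod_cast h2⟩
          intro w hw w' hw'
          obtain ⟨z, hz, rfl⟩ := Finset.mem_image.1 hw
          obtain ⟨z', hz', rfl⟩ := Finset.mem_image.1 hw'
          obtain ⟨a1, a2⟩ := hb z hz
          obtain ⟨b1, b2⟩ := hb z' hz'
          have e1 : |z.1 - z'.1| ≤ 4 * 2 ^ i := (abs_sub _ _).trans (by linarith)
          have e2 : |z.2 - z'.2| ≤ 4 * 2 ^ i := (abs_sub _ _).trans (by linarith)
          have e3 : |σ * (z.1 - z'.1)| ≤ 4 * 2 ^ i := by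
            rw [abs_mul]
            exact (mul_le_of_le_one_left (abs_nonneg _) hσ).trans e1
          push_cast
          constructor
          · have : (φ z).1 - (φ z').1 = z.1 - z'.1 := by simp only [φ]; ring
            rw [this]
            have : (0 : ℤ) < 2 ^ i := by positivity
            linarith
          · have : (φ z).2 - (φ z').2 = (z.2 - z'.2) - σ * (z.1 - z'.1) := by
              simp only [φ]; ring
            rw [this]
            exact (abs_sub _ _).trans (by linarith)
      rw [← ENNReal.ofReal_natCast, ← ENNReal.ofReal_mul (by positivity)]
      refine ENNReal.ofReal_le_ofReal ?_
      calc (t.card : ℝ) * (2 ^ δ * ((2 : ℝ) ^ i) ^ (-δ))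
          ≤ (C * ((8 * 2 ^ i : ℕ) : ℝ) ^ (δ / 2)) * (2 ^ δ * ((2 : ℝ) ^ i) ^ (-δ)) := by gcongr
        _ = A * r ^ i := by
          push_cast
          have h2i : ((2 : ℝ) ^ i) ^ (δ / 2) * ((2 : ℝ) ^ i) ^ (-δ) = r ^ i := by
            rw [← Real.rpow_add (by positivity), hr, ← Real.rpow_natCast, ← Real.rpow_natCast,
              ← Real.rpow_mul (by norm_num), ← Real.rpow_mul (by norm_num)]
            congr 1; ring
          rw [Real.mul_rpow (by norm_num) (by positivity), hA, ← h2i]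
          ring

/-- An interval of length `2` contains boundedly many multiples of `ϑ`. -/
theorem card_le_of_abs_mul_sub_le {ϑ : ℝ} (hϑ : 0 < ϑ) (μ : ℝ) :
    ∃ S : Finset ℤ, (S.card : ℝ) ≤ 2 / ϑ + 1 ∧ ∀ m : ℤ, |ϑ * m - μ| ≤ 1 → m ∈ S := by
  refine ⟨Finset.Icc ⌈(μ - 1) / ϑ⌉ ⌊(μ + 1) / ϑ⌋, ?_, fun m hm => ?_⟩
  · rw [Int.card_Icc]
    rcases le_total 0 (⌊(μ + 1) / ϑ⌋ + 1 - ⌈(μ - 1) / ϑ⌉) with h | h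
    · have h' : (((⌊(μ + 1) / ϑ⌋ + 1 - ⌈(μ - 1) / ϑ⌉).toNat : ℤ) : ℝ)
          = ((⌊(μ + 1) / ϑ⌋ + 1 - ⌈(μ - 1) / ϑ⌉ : ℤ) : ℝ) := by rw [Int.toNat_of_nonneg h]
      rw [Int.cast_natCast] at h'
      rw [h']; push_cast
      have h1 := Int.floor_le ((μ + 1) / ϑ)
      have h2 := Int.le_ceil ((μ - 1) / ϑ)
      have h3 : (μ + 1) / ϑ - (μ - 1) / ϑ = 2 / ϑ := by ring
      linarith
    · rw [Int.toNat_of_nonpos h]; push_cast; positivity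
  · obtain ⟨h1, h2⟩ := abs_le.1 hm
    rw [Finset.mem_Icc, Int.ceil_le, Int.le_floor, div_le_iff₀ hϑ, le_div_iff₀ hϑ]
    constructor <;> linarith

/-- The weighted number of lattice points in a hyperbolic strip `|ϑ p q - μ| ≤ 1`, without the
axes `p q = 0`. -/
theorem exists_tsum_hyperbolic_strip_le {δ ϑ : ℝ} (hδ : 0 < δ) (hϑ : 0 < ϑ) :
    ∃ C : ℝ≥0∞, C ≠ ⊤ ∧ ∀ (c d σ : ℤ) (μ : ℝ), |σ| ≤ 1 →
      ∑' z : ℤ × ℤ, (if (z.1 - c) * (z.2 - σ * z.1 - d) ≠ 0 ∧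
          |ϑ * ((z.1 - c) * (z.2 - σ * z.1 - d) : ℤ) - μ| ≤ 1 then
        ENNReal.ofReal (intBracket z.1 ^ (-δ) * intBracket z.2 ^ (-δ)) else 0) ≤ C := by
  obtain ⟨C, hC, h⟩ := exists_tsum_hyperbola_le hδ
  refine ⟨ENNReal.ofReal (2 / ϑ + 1) * C, ENNReal.mul_ne_top ENNReal.ofReal_ne_top hC,
    fun c d σ μ hσ => ?_⟩
  obtain ⟨S, hS, hmem⟩ := card_le_of_abs_mul_sub_le hϑ μ
  calc _ ≤ ∑' z : ℤ × ℤ, ∑ m ∈ S.erase 0, (if (z.1 - c) * (z.2 - σ * z.1 - d) = m then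
        ENNReal.ofReal (intBracket z.1 ^ (-δ) * intBracket z.2 ^ (-δ)) else 0) := by
        refine ENNReal.tsum_le_tsum fun z => ?_
        split_ifs with hz
        · refine le_trans ?_ (Finset.single_le_sum (fun _ _ => zero_le)
            (Finset.mem_erase.2 ⟨hz.1, hmem _ hz.2⟩))
          rw [if_pos rfl]
        · exact zero_le
    _ = ∑ m ∈ S.erase 0, ∑' z : ℤ × ℤ, (if (z.1 - c) * (z.2 - σ * z.1 - d) = m then
        ENNReal.ofReal (intBracket z.1 ^ (-δ) * intBracket z.2 ^ (-δ)) else 0) :=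
        Summable.tsum_finsetSum fun _ _ => ENNReal.summable
    _ ≤ ∑ m ∈ S.erase 0, C :=
        Finset.sum_le_sum fun m hm => h m c d σ (Finset.mem_erase.1 hm).1 hσ
    _ ≤ _ := by
        rw [Finset.sum_const, nsmul_eq_mul, ← ENNReal.ofReal_natCast]
        gcongr
        exact le_trans (by exact_mod_cast Finset.card_le_card (Finset.erase_subset _ _)) hS

/-! ### Bilinear resonance sums in `ℤ³` -/

theorem tsum_pi_fin_prod (n : ℕ) (f : Fin n → ℤ → ℝ≥0∞) :
    ∑' x : Fin n → ℤ, ∏ e, f e (x e) = ∏ e, ∑' t, f e t := by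
  induction n with
  | zero => simp
  | succ n ih =>
    rw [← (Fin.consEquiv (fun _ : Fin (n + 1) => ℤ)).tsum_eq,
      (ENNReal.summable.tsum_prod' fun _ => ENNReal.summable),
      Fin.prod_univ_succ, ← ih fun e => f e.succ, ← ENNReal.tsum_mul_right]
    refine tsum_congr fun t => ?_
    rw [← ENNReal.tsum_mul_left]
    refine tsum_congr fun x => ?_
    simp [Fin.consEquiv, Fin.prod_univ_succ]

theorem tsum_ite_le_of_injOn {X Y : Type*} {P : X → Prop} [DecidablePred P] {f : X → ℝ≥0∞} {F : Y → ℝ≥0∞}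
    (φ : X → Y) (hφ : ∀ x x', P x → P x' → φ x = φ x' → x = x')
    (hf : ∀ x, P x → f x ≤ F (φ x)) :
    ∑' x, (if P x then f x else 0) ≤ ∑' y, F y := by
  calc ∑' x, (if P x then f x else 0) = ∑' x : {x | P x}, f x := by
        rw [tsum_subtype]
        refine tsum_congr fun x => ?_
        simp [Set.indicator_apply]
    _ ≤ ∑' x : {x | P x}, F (φ x) := ENNReal.tsum_le_tsum fun x => hf x x.2
    _ ≤ ∑' y, F y := ENNReal.tsum_comp_le_tsum_of_injective
        (f := fun x : {x | P x} => φ x) (fun x x' h => Subtype.ext (hφ _ _ x.2 x'.2 h)) F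

section Bracket
variable {d : ℕ}

theorem one_le_japaneseBracket (x : Fin d → ℤ) : 1 ≤ japaneseBracket x :=
  Real.one_le_sqrt.2 (le_add_of_nonneg_right (Finset.sum_nonneg fun _ _ => sq_nonneg _))

theorem japaneseBracket_pos (x : Fin d → ℤ) : 0 < japaneseBracket x :=
  one_pos.trans_le (one_le_japaneseBracket x)

theorem intBracket_le_japaneseBracket (x : Fin d → ℤ) (e : Fin d) :
    intBracket (x e) ≤ japaneseBracket x := by
  refine Real.sqrt_le_sqrt (add_le_add_right ?_ 1)
  exact Finset.single_le_sum (f := fun a => (x a : ℝ) ^ 2) (fun _ _ => sq_nonneg _)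
    (Finset.mem_univ e)

/-- The decay of the bracket can be distributed over the coordinates. -/
theorem japaneseBracket_rpow_neg_le_prod (x : Fin d → ℤ) {s : ℝ} {r : Fin d → ℝ}
    (hr : ∀ e, 0 ≤ r e) (hs : ∑ e, r e ≤ s) :
    japaneseBracket x ^ (-s) ≤ ∏ e, intBracket (x e) ^ (-(r e)) := by
  calc japaneseBracket x ^ (-s) ≤ japaneseBracket x ^ (∑ e, -(r e)) := by
        refine Real.rpow_le_rpow_of_exponent_le (one_le_japaneseBracket x) ?_
        rw [Finset.sum_neg_distrib]; linarith
    _ = ∏ e, japaneseBracket x ^ (-(r e)) := Real.rpow_sum_of_pos (japaneseBracket_pos x) _ _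
    _ ≤ _ := Finset.prod_le_prod (fun e _ => Real.rpow_nonneg (japaneseBracket_pos x).le _)
        fun e _ => Real.rpow_le_rpow_of_nonpos (intBracket_pos _)
          (intBracket_le_japaneseBracket x e) (by linarith [hr e])

theorem tsum_japaneseBracket_rpow_neg_ne_top {β s : ℝ} (hβ : 1 < β) (hs : d * β ≤ s) :
    ∑' x : Fin d → ℤ, ENNReal.ofReal (japaneseBracket x ^ (-s)) ≠ ⊤ := by
  have h : ∑' x : Fin d → ℤ, ENNReal.ofReal (japaneseBracket x ^ (-s)) ≤
      ∑' x : Fin d → ℤ, ∏ e, ENNReal.ofReal (intBracket (x e) ^ (-β)) := by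
    refine ENNReal.tsum_le_tsum fun x => ?_
    rw [← ENNReal.ofReal_prod_of_nonneg fun e _ => Real.rpow_nonneg (intBracket_pos _).le _]
    refine ENNReal.ofReal_le_ofReal (japaneseBracket_rpow_neg_le_prod x (fun _ => by linarith) ?_)
    simpa using hs
  refine ne_top_of_le_ne_top ?_ h
  rw [tsum_pi_fin_prod d fun _ t => ENNReal.ofReal (intBracket t ^ (-β))]
  exact ENNReal.prod_ne_top fun _ _ => tsum_intBracket_rpow_neg_ne_top hβ

end Bracket

open scoped Classical in
/-- The part of a resonance sum in which the `a`-th coordinates contribute: with all the other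
coordinates frozen, the resonance condition becomes a hyperbolic strip in `ℤ²`. -/
theorem exists_tsum_coordinate_ne_zero_le {α : ℝ} (hα : 1 < α) {θ : Fin 3 → ℝ}
    (hθ : ∀ a, 0 < θ a) (a : Fin 3) :
    ∃ C : ℝ≥0∞, C ≠ ⊤ ∧ ∀ (c d : Fin 3 → ℤ) (σ : ℤ) (μ : ℝ), |σ| ≤ 1 →
      ∑' z : (Fin 3 → ℤ) × (Fin 3 → ℤ),
        (if (z.1 a - c a) * (z.2 a - σ * z.1 a - d a) ≠ 0 ∧
            |∑ e, θ e ^ 2 * ((z.1 e - c e) * (z.2 e - σ * z.1 e - d e) : ℤ) - μ| ≤ 1 then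
          ENNReal.ofReal (japaneseBracket z.1 ^ (-(2 * α)) * japaneseBracket z.2 ^ (-(2 * α)))
          else 0) ≤ C := by
  set δ := α - 1 with hδ
  set β := (α + 1) / 2 with hβ
  have hβ1 : 1 < β := by rw [hβ]; linarith
  obtain ⟨C, hC, h⟩ := exists_tsum_hyperbolic_strip_le (δ := δ) (by linarith)
    (pow_pos (hθ a) 2)
  let H : (Fin 2 → ℤ) → ℝ := fun x => ∏ i, intBracket (x i) ^ (-β)
  have hH0 : ∀ x, 0 ≤ H x := fun x =>
    Finset.prod_nonneg fun i _ => Real.rpow_nonneg (intBracket_pos _).le _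
  set T := ∑' x : Fin 2 → ℤ, ENNReal.ofReal (H x) with hT
  have hTtop : T ≠ ⊤ := by
    have : T = ∏ _e : Fin 2, ∑' t : ℤ, ENNReal.ofReal (intBracket t ^ (-β)) := by
      rw [← tsum_pi_fin_prod 2 fun _ t => ENNReal.ofReal (intBracket t ^ (-β)), hT]
      refine tsum_congr fun x => ?_
      exact ENNReal.ofReal_prod_of_nonneg fun e _ => Real.rpow_nonneg (intBracket_pos _).le _
    rw [this]
    exact ENNReal.prod_ne_top fun _ _ => tsum_intBracket_rpow_neg_ne_top hβ1
  refine ⟨T * (T * C), ENNReal.mul_ne_top hTtop (ENNReal.mul_ne_top hTtop hC),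
    fun c d σ μ hσ => ?_⟩
  have hw : ∀ (t : ℤ) (x : Fin 2 → ℤ),
      japaneseBracket (a.insertNth (α := fun _ => ℤ) t x) ^ (-(2 * α)) ≤
        intBracket t ^ (-δ) * H x := by
    intro t x
    refine (japaneseBracket_rpow_neg_le_prod _
      (r := a.insertNth (α := fun _ => ℝ) δ (fun _ => β)) ?_ ?_).trans (le_of_eq ?_)
    · intro e
      refine Fin.succAboveCases a ?_ (fun i => ?_) e
      · rw [Fin.insertNth_apply_same]; linarith
      · rw [Fin.insertNth_apply_succAbove]; linarith
    · rw [Fin.sum_univ_succAbove _ a]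
      simp only [Fin.insertNth_apply_same, Fin.insertNth_apply_succAbove, Fin.sum_univ_two]
      rw [hδ, hβ]; linarith
    · rw [Fin.prod_univ_succAbove _ a]
      simp only [Fin.insertNth_apply_same, Fin.insertNth_apply_succAbove, H]
  let E : (ℤ × ℤ) × ((Fin 2 → ℤ) × (Fin 2 → ℤ)) ≃ (Fin 3 → ℤ) × (Fin 3 → ℤ) :=
    (Equiv.prodProdProdComm ℤ ℤ (Fin 2 → ℤ) (Fin 2 → ℤ)).trans
      ((Fin.insertNthEquiv (fun _ : Fin 3 => ℤ) a).prodCongr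
        (Fin.insertNthEquiv (fun _ : Fin 3 => ℤ) a))
  rw [← E.tsum_eq, (ENNReal.summable.tsum_prod' fun _ => ENNReal.summable), ENNReal.tsum_comm,
    (ENNReal.summable.tsum_prod' fun _ => ENNReal.summable), hT,
    ← ENNReal.tsum_mul_right]
  refine ENNReal.tsum_le_tsum fun x => ?_
  rw [← hT, hT, ← ENNReal.tsum_mul_right, ← ENNReal.tsum_mul_left]
  refine ENNReal.tsum_le_tsum fun y => ?_
  refine le_trans ?_ (mul_le_mul_right (mul_le_mul_right (h (c a) (d a) σ
    (μ - ∑ i : Fin 2, θ (a.succAbove i) ^ 2 *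
      ((x i - c (a.succAbove i)) * (y i - σ * x i - d (a.succAbove i)) : ℤ)) hσ) _) _)
  rw [← ENNReal.tsum_mul_left, ← ENNReal.tsum_mul_left]
  refine ENNReal.tsum_le_tsum fun z => ?_
  have hE : E (z, (x, y)) = (a.insertNth (α := fun _ => ℤ) z.1 x,
      a.insertNth (α := fun _ => ℤ) z.2 y) := rfl
  rw [hE]
  simp only [Fin.insertNth_apply_same]
  rw [Fin.sum_univ_succAbove _ a]
  simp only [Fin.insertNth_apply_same, Fin.insertNth_apply_succAbove]
  split_ifs with h1 h2 h2
  · rw [← ENNReal.ofReal_mul (hH0 y), ← ENNReal.ofReal_mul (hH0 x)]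
    refine ENNReal.ofReal_le_ofReal ?_
    calc _ ≤ (intBracket z.1 ^ (-δ) * H x) * (intBracket z.2 ^ (-δ) * H y) :=
          mul_le_mul (hw _ _) (hw _ _) (Real.rpow_nonneg (japaneseBracket_pos _).le _)
            (mul_nonneg (Real.rpow_nonneg (intBracket_pos _).le _) (hH0 x))
      _ = _ := by ring
  · refine absurd ⟨h1.1, ?_⟩ h2
    rw [sub_sub_eq_add_sub]
    exact h1.2
  · exact zero_le
  · exact zero_le

open scoped Classical in
/-- The part of a resonance sum in which every coordinate contributes `0`. Here `s` records which
of the two factors vanishes; both factors occur, so the decay in each of the two variables is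
only needed for at most two coordinates. -/
theorem tsum_coordinates_eq_zero_le {α β : ℝ} (hβ : 0 ≤ β) (hβα : β ≤ α) (s : Fin 3 → Bool)
    (hs : ∃ e, s e = true) (hs' : ∃ e, s e = false) (c d : Fin 3 → ℤ) (σ : ℤ) :
    ∑' z : (Fin 3 → ℤ) × (Fin 3 → ℤ),
      (if ∀ e, if s e then z.1 e = c e else z.2 e = σ * z.1 e + d e then
        ENNReal.ofReal (japaneseBracket z.1 ^ (-(2 * α)) * japaneseBracket z.2 ^ (-(2 * α)))
        else 0) ≤ (∑' t : ℤ, ENNReal.ofReal (intBracket t ^ (-β))) ^ 3 := by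
  have hpow : (∑' t : ℤ, ENNReal.ofReal (intBracket t ^ (-β))) ^ 3 =
      ∑' x : Fin 3 → ℤ, ∏ e, ENNReal.ofReal (intBracket (x e) ^ (-β)) := by
    rw [tsum_pi_fin_prod 3 fun _ t => ENNReal.ofReal (intBracket t ^ (-β))]
    simp
  rw [hpow]
  refine tsum_ite_le_of_injOn (fun (z : (Fin 3 → ℤ) × (Fin 3 → ℤ)) (e : Fin 3) =>
    if s e then z.2 e else z.1 e) ?_ ?_
  · rintro ⟨x, y⟩ ⟨x', y'⟩ h h' heq
    have h1 : x = x' := by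
      funext e
      have a1 := h e
      have a2 := h' e
      have a3 := congrFun heq e
      by_cases hse : s e = true
      · simp only [hse, if_true] at a1 a2; rw [a1, a2]
      · simpa [hse] using a3
    subst h1
    refine Prod.ext rfl ?_
    funext e
    have a1 := h e
    have a2 := h' e
    have a3 := congrFun heq e
    by_cases hse : s e = true
    · simpa [hse] using a3
    · simp only [hse] at a1 a2
      exact a1.trans a2.symm
  · rintro ⟨x, y⟩ -
    rw [← ENNReal.ofReal_prod_of_nonneg fun e _ => Real.rpow_nonneg (intBracket_pos _).le _]
    refine ENNReal.ofReal_le_ofReal ?_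
    have hx : japaneseBracket x ^ (-(2 * α)) ≤
        ∏ e, intBracket (x e) ^ (-(if s e then 0 else β)) := by
      refine japaneseBracket_rpow_neg_le_prod x (fun e => by split_ifs <;> simp [hβ]) ?_
      obtain ⟨e, he⟩ := hs
      rw [Fin.sum_univ_succAbove _ e, he, Fin.sum_univ_two]
      have : ∀ i, (if s i = true then 0 else β) ≤ α := fun i => by split_ifs <;> linarith
      have h0 := this (e.succAbove 0)
      have h1 := this (e.succAbove 1)
      simp only [if_true]
      linarith
    have hy : japaneseBracket y ^ (-(2 * α)) ≤
        ∏ e, intBracket (y e) ^ (-(if s e then β else 0)) := by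
      refine japaneseBracket_rpow_neg_le_prod y (fun e => by split_ifs <;> simp [hβ]) ?_
      obtain ⟨e, he⟩ := hs'
      rw [Fin.sum_univ_succAbove _ e, he, Fin.sum_univ_two]
      have : ∀ i, (if s i = true then β else 0) ≤ α := fun i => by split_ifs <;> linarith
      have h0 := this (e.succAbove 0)
      have h1 := this (e.succAbove 1)
      simp only [Bool.false_eq_true, if_false]
      linarith
    refine (mul_le_mul hx hy (Real.rpow_nonneg (japaneseBracket_pos _).le _)
      (Finset.prod_nonneg fun e _ => Real.rpow_nonneg (intBracket_pos _).le _)).trans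
      (le_of_eq ?_)
    rw [← Finset.prod_mul_distrib]
    refine Finset.prod_congr rfl fun e _ => ?_
    by_cases hse : s e = true <;> simp [hse]

open scoped Classical in
/-- The bilinear resonance estimate: the weighted number of pairs `(x, y)` with
`∑ₑ θₑ² pₑ qₑ = μ + O(1)`, where `p = x - c` and `q = y - σ x - d` are nonzero. -/
theorem exists_tsum_bilinear_resonance_le {α : ℝ} (hα : 1 < α) {θ : Fin 3 → ℝ}
    (hθ : ∀ a, 0 < θ a) :
    ∃ C : ℝ≥0∞, C ≠ ⊤ ∧ ∀ (c d : Fin 3 → ℤ) (σ : ℤ) (μ : ℝ), |σ| ≤ 1 →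
      ∑' z : (Fin 3 → ℤ) × (Fin 3 → ℤ),
        (if (∃ e, z.1 e - c e ≠ 0) ∧ (∃ e, z.2 e - σ * z.1 e - d e ≠ 0) ∧
            |∑ e, θ e ^ 2 * ((z.1 e - c e) * (z.2 e - σ * z.1 e - d e) : ℤ) - μ| ≤ 1 then
          ENNReal.ofReal (japaneseBracket z.1 ^ (-(2 * α)) * japaneseBracket z.2 ^ (-(2 * α)))
          else 0) ≤ C := by
  choose C hC h using exists_tsum_coordinate_ne_zero_le hα hθ
  set T := (∑' t : ℤ, ENNReal.ofReal (intBracket t ^ (-α))) ^ 3 with hT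
  have hTtop : T ≠ ⊤ := ENNReal.pow_ne_top (tsum_intBracket_rpow_neg_ne_top hα)
  let N : Finset (Fin 3 → Bool) :=
    Finset.univ.filter fun s => (∃ e, s e = true) ∧ ∃ e, s e = false
  refine ⟨∑ a, C a + ∑ s ∈ N, T, ?_, fun c d σ μ hσ => ?_⟩
  · exact ENNReal.add_ne_top.2 ⟨ENNReal.sum_ne_top.2 fun a _ => hC a,
      ENNReal.sum_ne_top.2 fun _ _ => hTtop⟩
  refine le_trans ?_ (add_le_add (Finset.sum_le_sum fun a _ => h a c d σ μ hσ)
    (Finset.sum_le_sum fun s hs => tsum_coordinates_eq_zero_le (by linarith) le_rfl s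
      (Finset.mem_filter.1 hs).2.1 (Finset.mem_filter.1 hs).2.2 c d σ))
  rw [← Summable.tsum_finsetSum fun _ _ => ENNReal.summable,
    ← Summable.tsum_finsetSum fun _ _ => ENNReal.summable, ← ENNReal.tsum_add]
  refine ENNReal.tsum_le_tsum fun z => ?_
  split_ifs with hz
  · obtain ⟨⟨e₁, h₁⟩, ⟨e₂, h₂⟩, hμ⟩ := hz
    by_cases ha : ∃ a, (z.1 a - c a) * (z.2 a - σ * z.1 a - d a) ≠ 0
    · obtain ⟨a, ha⟩ := ha
      refine le_trans ?_ le_self_add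
      refine le_trans ?_ (Finset.single_le_sum (fun _ _ => zero_le) (Finset.mem_univ a))
      rw [if_pos ⟨ha, hμ⟩]
    · push Not at ha
      refine le_trans ?_ le_add_self
      have hs : (fun e => decide (z.1 e - c e = 0)) ∈ N := by
        refine Finset.mem_filter.2 ⟨Finset.mem_univ _, ⟨e₂, ?_⟩, ⟨e₁, ?_⟩⟩
        · simpa [h₂] using ha e₂
        · simpa using h₁
      refine le_trans ?_ (Finset.single_le_sum (fun _ _ => zero_le) hs)
      rw [if_pos]
      intro e
      by_cases he : z.1 e - c e = 0
      · simpa [he] using sub_eq_zero.1 he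
      · have := (mul_eq_zero.1 (ha e)).resolve_left he
        simp only [he, decide_false, Bool.false_eq_true, if_false]
        linarith
  · exact zero_le

/-! ### The resonance and trace sums of the collision operator -/

theorem japaneseBracket_sq {d : ℕ} (x : Fin d → ℤ) :
    japaneseBracket x ^ 2 = 1 + ∑ a, (x a : ℝ) ^ 2 :=
  Real.sq_sqrt (add_nonneg zero_le_one (Finset.sum_nonneg fun _ _ => sq_nonneg _))

theorem japaneseBracket_sq_le {d : ℕ} (n x y : Fin d → ℤ) :
    japaneseBracket n ^ 2 ≤
      3 * (japaneseBracket (n - x + y) ^ 2 + japaneseBracket x ^ 2 + japaneseBracket y ^ 2) := by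
  simp only [japaneseBracket_sq]
  have h : ∑ a, (n a : ℝ) ^ 2 ≤
      ∑ a, 3 * (((n - x + y) a : ℝ) ^ 2 + (x a : ℝ) ^ 2 + (y a : ℝ) ^ 2) := by
    refine Finset.sum_le_sum fun a _ => ?_
    simp only [Pi.add_apply, Pi.sub_apply]
    push_cast
    nlinarith [sq_nonneg ((n a : ℝ) - x a + y a - x a), sq_nonneg ((n a : ℝ) - x a + y a + y a),
      sq_nonneg ((x a : ℝ) + y a)]
  rw [← Finset.mul_sum, Finset.sum_add_distrib, Finset.sum_add_distrib] at h
  linarith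

theorem rpow_japaneseBracket_le {d : ℕ} (n x y : Fin d → ℤ) {s : ℝ} (hs : 0 ≤ s) :
    japaneseBracket n ^ s ≤ 3 ^ s *
      (japaneseBracket (n - x + y) ^ s + japaneseBracket x ^ s + japaneseBracket y ^ s) := by
  have h := japaneseBracket_sq_le n x y
  set a := japaneseBracket (n - x + y)
  set b := japaneseBracket x
  set c := japaneseBracket y
  have ha : 0 < a := japaneseBracket_pos _
  have hb : 0 < b := japaneseBracket_pos _
  have hc : 0 < c := japaneseBracket_pos _
  have hn := japaneseBracket_pos n
  have hmax : japaneseBracket n ≤ 3 * a ∨ japaneseBracket n ≤ 3 * b ∨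
      japaneseBracket n ≤ 3 * c := by
    by_contra! hcon
    nlinarith [hcon.1, hcon.2.1, hcon.2.2]
  have key : ∀ z, 0 < z → japaneseBracket n ≤ 3 * z → japaneseBracket n ^ s ≤ 3 ^ s * z ^ s := by
    intro z hz h
    rw [← Real.mul_rpow (by norm_num) hz.le]
    exact Real.rpow_le_rpow hn.le h hs
  have h3 : (0 : ℝ) < 3 ^ s := by positivity
  have pa : 0 < a ^ s := by positivity
  have pb : 0 < b ^ s := by positivity
  have pc : 0 < c ^ s := by positivity
  rcases hmax with h | h | h
  · exact (key _ ha h).trans (by gcongr; linarith)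
  · exact (key _ hb h).trans (by gcongr; linarith)
  · exact (key _ hc h).trans (by gcongr; linarith)

/-- Bound of the number of resonant interactions, weighted as in a trilinear estimate in
`H^α`: if `n₁ + n₂ - n₃ = n`, then `Q(n) - Q(n₁) - Q(n₂) + Q(n₃)` is twice the bilinear form of `Q`
at `n₁ - n` and `n₂ - n`. The largest of the `⟨nᵢ⟩` absorbs `⟨n⟩`, which leaves the bilinear
resonance sum in the other two frequencies. Here `n₂` and `n₃` are the two entries of `p`. -/
theorem exists_tsum_resonance_le {α : ℝ} (hα : 1 < α) {θ : Fin 3 → ℝ} (hθ : ∀ a, 0 < θ a) :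
    ∃ C : ℝ≥0∞, C ≠ ⊤ ∧ ∀ (n : Fin 3 → ℤ) (μ : ℝ),
      ∑' p : (Fin 3 → ℤ) × (Fin 3 → ℤ),
        (if |quadForm θ (n - p.1 + p.2) + quadForm θ p.1 - quadForm θ p.2 - μ| ≤ 1 then
          ENNReal.ofReal (japaneseBracket n ^ (2 * α) *
            (japaneseBracket (n - p.1 + p.2) ^ (-(2 * α)) *
              (japaneseBracket p.1 ^ (-(2 * α)) * japaneseBracket p.2 ^ (-(2 * α))))) else 0)
        ≤ C := by
  classical
  obtain ⟨C, hC, h⟩ := exists_tsum_bilinear_resonance_le hα hθ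
  set T := ∑' x : Fin 3 → ℤ, ENNReal.ofReal (japaneseBracket x ^ (-(4 * α))) with hT
  have hTtop : T ≠ ⊤ := tsum_japaneseBracket_rpow_neg_ne_top hα (by push_cast; linarith)
  set K : ℝ≥0∞ := ENNReal.ofReal (3 ^ (2 * α)) with hK
  refine ⟨T + T + K * (C + C + C), ?_, fun n μ => ?_⟩
  · simp only [ne_eq, ENNReal.add_eq_top, not_or]
    exact ⟨⟨hTtop, hTtop⟩, ENNReal.mul_ne_top ENNReal.ofReal_ne_top (by simp [hC])⟩
  let J : (Fin 3 → ℤ) → ℝ := fun x => japaneseBracket x ^ (-(2 * α))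
  have hJ : ∀ x, 0 < J x := fun x => Real.rpow_pos_of_pos (japaneseBracket_pos x) _
  have hJinv : ∀ x, japaneseBracket x ^ (2 * α) * J x = 1 := fun x => by
    simp only [J]
    rw [← Real.rpow_add (japaneseBracket_pos x)]; simp
  have hJJ : ∀ x, J x * J x = japaneseBracket x ^ (-(4 * α)) := fun x => by
    simp only [J]
    rw [← Real.rpow_add (japaneseBracket_pos x)]; congr 1; ring
  let ν : ℝ := (quadForm θ n - μ) / 2
  let R : (Fin 3 → ℤ) × (Fin 3 → ℤ) → Prop := fun p =>
    (∃ e, n e - p.1 e + p.2 e - n e ≠ 0) ∧ (∃ e, p.1 e - n e ≠ 0) ∧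
      |∑ e, θ e ^ 2 * ((n e - p.1 e + p.2 e - n e) * (p.1 e - n e) : ℤ) - ν| ≤ 1
  have h1 : ∑' p : (Fin 3 → ℤ) × (Fin 3 → ℤ), (if p.1 = p.2 then
      ENNReal.ofReal (J p.1 * J p.2) else 0) ≤ T :=
    tsum_ite_le_of_injOn Prod.fst
      (by rintro ⟨x, y⟩ ⟨x', y'⟩ hp hp' hxx; simp only at hp hp' hxx; simp [← hp, ← hp', hxx])
      (by rintro ⟨x, y⟩ hp; simp only at hp; rw [← hp]; exact (congrArg _ (hJJ x)).le)
  have h2 : ∑' p : (Fin 3 → ℤ) × (Fin 3 → ℤ), (if p.1 = n then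
      ENNReal.ofReal (J p.2 * J p.2) else 0) ≤ T :=
    tsum_ite_le_of_injOn Prod.snd
      (by rintro ⟨x, y⟩ ⟨x', y'⟩ hp hp' hxx; simp only at hp hp' hxx; simp [hp, hp', hxx])
      (by rintro ⟨x, y⟩ hp; exact (congrArg _ (hJJ y)).le)
  have h3 : ∑' p : (Fin 3 → ℤ) × (Fin 3 → ℤ), (if R p then
      ENNReal.ofReal (J p.1 * J p.2) else 0) ≤ C := by
    refine (tsum_ite_le_of_injOn id (fun _ _ _ _ h => h) ?_).trans (h n 0 1 ν (by simp))
    rintro ⟨x, y⟩ ⟨⟨e₁, he₁⟩, ⟨e₂, he₂⟩, hμ⟩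
    rw [if_pos]; · rfl
    refine ⟨⟨e₂, he₂⟩, ⟨e₁, ?_⟩, ?_⟩
    · simp only [id, Pi.zero_apply] at he₁ ⊢
      intro h0; apply he₁; linarith
    · refine le_of_eq_of_le ?_ hμ
      congr 2
      refine Finset.sum_congr rfl fun e _ => ?_
      simp only [id, Pi.zero_apply]; push_cast; ring
  have h4 : ∑' p : (Fin 3 → ℤ) × (Fin 3 → ℤ), (if R p then
      ENNReal.ofReal (J (n - p.1 + p.2) * J p.2) else 0) ≤ C := by
    refine (tsum_ite_le_of_injOn (fun p => (n - p.1 + p.2, p.2)) ?_ ?_).trans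
      (h n 0 1 ν (by simp))
    · rintro ⟨x, y⟩ ⟨x', y'⟩ - - heq
      simp only [Prod.mk.injEq] at heq
      obtain ⟨e1, rfl⟩ := heq
      simpa using e1
    · rintro ⟨x, y⟩ ⟨⟨e₁, he₁⟩, ⟨e₂, he₂⟩, hμ⟩
      rw [if_pos]
      refine ⟨⟨e₁, by simpa using he₁⟩, ⟨e₂, ?_⟩, ?_⟩
      · simp only [Pi.add_apply, Pi.sub_apply, Pi.zero_apply] at he₂ ⊢
        intro h0; apply he₂; linarith
      · refine le_of_eq_of_le ?_ hμ
        congr 2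
        refine Finset.sum_congr rfl fun e _ => ?_
        simp only [Pi.add_apply, Pi.sub_apply, Pi.zero_apply]; push_cast; ring
  have h5 : ∑' p : (Fin 3 → ℤ) × (Fin 3 → ℤ), (if R p then
      ENNReal.ofReal (J (n - p.1 + p.2) * J p.1) else 0) ≤ C := by
    refine (tsum_ite_le_of_injOn (fun p => (n - p.1 + p.2, p.1)) ?_ ?_).trans
      (h n n 0 ν (by simp))
    · rintro ⟨x, y⟩ ⟨x', y'⟩ - - heq
      simp only [Prod.mk.injEq] at heq
      obtain ⟨e1, rfl⟩ := heq
      simpa using e1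
    · rintro ⟨x, y⟩ ⟨⟨e₁, he₁⟩, ⟨e₂, he₂⟩, hμ⟩
      rw [if_pos]
      refine ⟨⟨e₁, by simpa using he₁⟩, ⟨e₂, by simpa using he₂⟩, ?_⟩
      refine le_of_eq_of_le ?_ hμ
      congr 2
      refine Finset.sum_congr rfl fun e _ => ?_
      simp only [Pi.add_apply, Pi.sub_apply]; push_cast; ring
  refine le_trans ?_ (add_le_add (add_le_add h1 h2)
    (mul_le_mul_right (add_le_add (add_le_add h3 h4) h5) K))
  rw [← ENNReal.tsum_add, ← ENNReal.tsum_add, ← ENNReal.tsum_add, ← ENNReal.tsum_mul_left,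
    ← ENNReal.tsum_add]
  refine ENNReal.tsum_le_tsum ?_
  rintro ⟨x, y⟩
  simp only
  by_cases hμ : |quadForm θ (n - x + y) + quadForm θ x - quadForm θ y - μ| ≤ 1
  swap
  · rw [if_neg hμ]; exact zero_le
  rw [if_pos hμ]
  change ENNReal.ofReal (japaneseBracket n ^ (2 * α) * (J (n - x + y) * (J x * J y))) ≤ _
  by_cases hxy : x = y
  · refine le_trans ?_ (le_self_add.trans le_self_add)
    rw [if_pos hxy]
    refine ENNReal.ofReal_le_ofReal (le_of_eq ?_)
    rw [hxy, sub_add_cancel, ← mul_assoc, hJinv, one_mul]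
  by_cases hxn : x = n
  · refine le_trans ?_ (le_add_self.trans le_self_add)
    rw [if_pos hxn]
    refine ENNReal.ofReal_le_ofReal (le_of_eq ?_)
    rw [hxn, sub_self, zero_add, mul_left_comm, ← mul_assoc (japaneseBracket n ^ (2 * α)), hJinv,
      one_mul]
  refine le_trans ?_ le_add_self
  have hR : R (x, y) := by
    refine ⟨?_, ?_, ?_⟩
    · by_contra! hcon
      apply hxy
      funext e
      have := hcon e
      simp only at this
      linarith
    · by_contra! hcon
      exact hxn (funext fun e => sub_eq_zero.1 (hcon e))
    · have hid : ∑ e, θ e ^ 2 * ((n e - x e + y e - n e) * (x e - n e) : ℤ) - ν =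
          -((quadForm θ (n - x + y) + quadForm θ x - quadForm θ y - μ) / 2) := by
        have : ∑ e, θ e ^ 2 * (((n e - x e + y e - n e) * (x e - n e) : ℤ) : ℝ) =
            (quadForm θ n - quadForm θ (n - x + y) - quadForm θ x + quadForm θ y) / 2 := by
          simp only [quadForm]
          rw [← Finset.sum_sub_distrib, ← Finset.sum_sub_distrib, ← Finset.sum_add_distrib,
            Finset.sum_div]
          refine Finset.sum_congr rfl fun e _ => ?_
          simp only [Pi.add_apply, Pi.sub_apply]
          push_cast; ring
        rw [this]; simp only [ν]; ring
      rw [hid, abs_neg, abs_div, abs_two]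
      linarith
  rw [if_pos hR, if_pos hR, if_pos hR,
    ← ENNReal.ofReal_add (by have := hJ x; have := hJ y; positivity)
    (by have := hJ (n - x + y); have := hJ y; positivity), ← ENNReal.ofReal_add
    (by have := hJ x; have := hJ y; have := hJ (n - x + y); positivity)
    (by have := hJ (n - x + y); have := hJ x; positivity), hK, ← ENNReal.ofReal_mul (by positivity)]
  refine ENNReal.ofReal_le_ofReal ?_
  have p : 0 ≤ J (n - x + y) * (J x * J y) :=
    (mul_pos (hJ _) (mul_pos (hJ _) (hJ _))).le
  refine (mul_le_mul_of_nonneg_right (rpow_japaneseBracket_le n x y (by linarith)) p).trans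
    (le_of_eq ?_)
  linear_combination (3 ^ (2 * α) * (J x * J y)) * hJinv (n - x + y) +
    (3 ^ (2 * α) * (J (n - x + y) * J y)) * hJinv x +
    (3 ^ (2 * α) * (J (n - x + y) * J x)) * hJinv y

/-- The sum behind the trace estimate. It converges because the product of three numbers squared is
at most the sum of the cubes of the products of two of them. -/
theorem exists_tsum_trace_le {α : ℝ} (hα : 1 < α) :
    ∃ C : ℝ≥0∞, C ≠ ⊤ ∧ ∀ n : Fin 3 → ℤ,
      ∑' p : (Fin 3 → ℤ) × (Fin 3 → ℤ),
        ENNReal.ofReal (japaneseBracket (n - p.1 + p.2) ^ (-(2 * α)) *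
          (japaneseBracket p.1 ^ (-(2 * α)) * japaneseBracket p.2 ^ (-(2 * α)))) ≤ C := by
  set T := ∑' x : Fin 3 → ℤ, ENNReal.ofReal (japaneseBracket x ^ (-(3 * α))) with hT
  have hTtop : T ≠ ⊤ := tsum_japaneseBracket_rpow_neg_ne_top hα (by push_cast; linarith)
  refine ⟨T * T + T * T + T * T, by simp [ENNReal.mul_eq_top, hTtop], fun n => ?_⟩
  let F : (Fin 3 → ℤ) × (Fin 3 → ℤ) → ℝ≥0∞ := fun p =>
    ENNReal.ofReal (japaneseBracket p.1 ^ (-(3 * α))) *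
      ENNReal.ofReal (japaneseBracket p.2 ^ (-(3 * α)))
  have hF : ∑' p, F p = T * T := by
    rw [ENNReal.summable.tsum_prod' fun _ => ENNReal.summable]
    simp only [F, ENNReal.tsum_mul_left, ENNReal.tsum_mul_right, ← hT]
  have h2 : ∑' p : (Fin 3 → ℤ) × (Fin 3 → ℤ), F (n - p.1 + p.2, p.2) ≤ T * T := by
    rw [← hF]
    refine ENNReal.tsum_comp_le_tsum_of_injective
      (f := fun p : (Fin 3 → ℤ) × (Fin 3 → ℤ) => (n - p.1 + p.2, p.2)) ?_ F
    rintro ⟨x, y⟩ ⟨x', y'⟩ heq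
    simp only [Prod.mk.injEq] at heq
    obtain ⟨e1, rfl⟩ := heq
    simpa using e1
  have h3 : ∑' p : (Fin 3 → ℤ) × (Fin 3 → ℤ), F (n - p.1 + p.2, p.1) ≤ T * T := by
    rw [← hF]
    refine ENNReal.tsum_comp_le_tsum_of_injective
      (f := fun p : (Fin 3 → ℤ) × (Fin 3 → ℤ) => (n - p.1 + p.2, p.1)) ?_ F
    rintro ⟨x, y⟩ ⟨x', y'⟩ heq
    simp only [Prod.mk.injEq] at heq
    obtain ⟨e1, rfl⟩ := heq
    simpa using e1
  refine le_trans ?_ (add_le_add (add_le_add hF.le h2) h3)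
  rw [← ENNReal.tsum_add, ← ENNReal.tsum_add]
  refine ENNReal.tsum_le_tsum ?_
  rintro ⟨x, y⟩
  have e2 : ∀ z : Fin 3 → ℤ, japaneseBracket z ^ (-(2 * α)) = (japaneseBracket z ^ (-α)) ^ 2 := by
    intro z
    rw [← Real.rpow_natCast, ← Real.rpow_mul (japaneseBracket_pos z).le]; congr 1; push_cast; ring
  have e3 : ∀ z : Fin 3 → ℤ, japaneseBracket z ^ (-(3 * α)) = (japaneseBracket z ^ (-α)) ^ 3 := by
    intro z
    rw [← Real.rpow_natCast, ← Real.rpow_mul (japaneseBracket_pos z).le]; congr 1; push_cast; ring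
  have hp : ∀ z : Fin 3 → ℤ, 0 < japaneseBracket z ^ (-α) := fun z =>
    Real.rpow_pos_of_pos (japaneseBracket_pos z) _
  simp only [F, e2, e3]
  have pa := hp (n - x + y)
  have pb := hp x
  have pc := hp y
  set a := japaneseBracket (n - x + y) ^ (-α)
  set b := japaneseBracket x ^ (-α)
  set c := japaneseBracket y ^ (-α)
  rw [← ENNReal.ofReal_mul (by positivity), ← ENNReal.ofReal_mul (by positivity),
    ← ENNReal.ofReal_mul (by positivity), ← ENNReal.ofReal_add (by positivity) (by positivity),
    ← ENNReal.ofReal_add (by positivity) (by positivity)]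
  refine ENNReal.ofReal_le_ofReal ?_
  -- If `z` is the smallest of the three numbers, then `x² y² z² ≤ x³ y³`.
  have key : ∀ x y z : ℝ, 0 < x → 0 < y → 0 < z → z ≤ x → z ≤ y →
      x ^ 2 * (y ^ 2 * z ^ 2) ≤ x ^ 3 * y ^ 3 := by
    intro x y z hx hy hz h1 h2
    have : z ^ 2 ≤ x * y := by rw [sq]; exact mul_le_mul h1 h2 hz.le hx.le
    calc x ^ 2 * (y ^ 2 * z ^ 2) = (x ^ 2 * y ^ 2) * z ^ 2 := by ring
      _ ≤ (x ^ 2 * y ^ 2) * (x * y) := by gcongr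
      _ = _ := by ring
  have q1 : 0 < b ^ 3 * c ^ 3 := by positivity
  have q2 : 0 < a ^ 3 * c ^ 3 := by positivity
  have q3 : 0 < a ^ 3 * b ^ 3 := by positivity
  rcases le_total a b with hab | hab
  · rcases le_total a c with hac | hac
    · have := key b c a pb pc pa hab hac; linarith
    · have := key a b c pa pb pc hac (hac.trans hab); linarith
  · rcases le_total b c with hbc | hbc
    · have := key a c b pa pc pb hab hbc; linarith
    · have := key a b c pa pb pc (hbc.trans hab) hbc; linarith

/-! ### Series in `L²` and a mean value estimate for exponential sums -/

theorem eLpNorm_two_sq {Ω : Type*} [MeasurableSpace Ω] (μ : Measure Ω) (f : Ω → ℂ) :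
    eLpNorm f 2 μ ^ 2 = ∫⁻ x, ‖f x‖ₑ ^ 2 ∂μ := by
  have h := eLpNorm_nnreal_pow_eq_lintegral (μ := μ) (f := f) (p := 2) (by norm_num)
  simpa using h

/-- A series of functions converges unconditionally in `L²` as soon as the squared norms of its
finite partial sums are controlled by the corresponding partial sums of a convergent series. -/
theorem exists_tendsto_eLpNorm_sum_sub {Ω X : Type*} [MeasurableSpace Ω] {μ : Measure Ω}
    {f : X → Ω → ℂ} (hf : ∀ x, MemLp (f x) 2 μ) {g : X → ℝ} (hg0 : ∀ x, 0 ≤ g x)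
    (hg : Summable g)
    (h : ∀ F : Finset X, eLpNorm (fun z => ∑ x ∈ F, f x z) 2 μ ^ 2 ≤
      ENNReal.ofReal (∑ x ∈ F, g x)) :
    ∃ G : Ω → ℂ, MemLp G 2 μ ∧
      Tendsto (fun F : Finset X => eLpNorm (fun z => ∑ x ∈ F, f x z - G z) 2 μ) atTop (𝓝 0) ∧
      eLpNorm G 2 μ ^ 2 ≤ ENNReal.ofReal (∑' x, g x) := by
  let u : X → Lp ℂ 2 μ := fun x => (hf x).toLp
  have hu : ∀ F : Finset X, (∑ x ∈ F, u x : Lp ℂ 2 μ) =ᵐ[μ] fun z => ∑ x ∈ F, f x z := by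
    intro F
    have h1 : ∀ᵐ z ∂μ, ∀ x ∈ F, u x z = f x z :=
      (Filter.eventually_all_finset F).2 fun x _ => (hf x).coeFn_toLp
    filter_upwards [h1, Lp.coeFn_finsetSum F u] with z hz hz'
    rw [hz', Finset.sum_apply]
    exact Finset.sum_congr rfl hz
  have henorm : ∀ F : Finset X, ‖∑ x ∈ F, u x‖ ^ 2 ≤ ∑ x ∈ F, g x := by
    intro F
    have h1 : ENNReal.ofReal (‖∑ x ∈ F, u x‖ ^ 2) ≤ ENNReal.ofReal (∑ x ∈ F, g x) := by
      rw [ENNReal.ofReal_pow (norm_nonneg _), ofReal_norm, Lp.enorm_def,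
        eLpNorm_congr_ae (hu F)]
      exact h F
    exact (ENNReal.ofReal_le_ofReal_iff (Finset.sum_nonneg fun x _ => hg0 x)).1 h1
  have hsum : Summable u := by
    rw [summable_iff_vanishing_norm]
    intro ε hε
    obtain ⟨s, hs⟩ := summable_iff_vanishing_norm.1 hg (ε ^ 2) (by positivity)
    refine ⟨s, fun t ht => ?_⟩
    have h1 := (henorm t).trans_lt ((le_abs_self _).trans_lt (hs t ht))
    exact lt_of_pow_lt_pow_left₀ 2 hε.le h1
  set U : Lp ℂ 2 μ := ∑' x, u x with hU
  have htend : Tendsto (fun F : Finset X => ∑ x ∈ F, u x) atTop (𝓝 U) := hsum.hasSum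
  refine ⟨U, Lp.memLp U, ?_, ?_⟩
  · have h1 : Tendsto (fun F : Finset X => ‖∑ x ∈ F, u x - U‖ₑ) atTop (𝓝 0) :=
      (tendsto_iff_edist_tendsto_0.1 htend).congr fun F => edist_eq_enorm_sub _ _
    refine h1.congr fun F => ?_
    rw [Lp.enorm_def]
    refine eLpNorm_congr_ae ?_
    filter_upwards [hu F, Lp.coeFn_sub (∑ x ∈ F, u x) U] with z hz hz'
    rw [hz', Pi.sub_apply, hz]
  · have h1 : ‖U‖ ^ 2 ≤ ∑' x, g x :=
      le_of_tendsto' ((htend.norm).pow 2) fun F =>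
        (henorm F).trans (hg.sum_le_tsum F fun x _ => hg0 x)
    have h2 := ENNReal.ofReal_le_ofReal h1
    rwa [ENNReal.ofReal_pow (norm_nonneg _), ofReal_norm, Lp.enorm_def] at h2

section Time
variable {X : Type*}

/-- The constant in the mean value estimate `lintegral_enorm_sq_exp_sum_le`. -/
noncomputable def meanValueConst : ℝ :=
  Real.exp 1 * √π * (8 * ∑' m : ℤ, intBracket m ^ (-2 : ℝ))

theorem meanValueConst_nonneg : 0 ≤ meanValueConst := by
  have : 0 ≤ ∑' m : ℤ, intBracket m ^ (-2 : ℝ) :=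
    tsum_nonneg fun m => Real.rpow_nonneg (intBracket_pos m).le _
  unfold meanValueConst
  positivity

theorem exp_neg_sq_div_four_le (ν : ℝ) :
    Real.exp (-ν ^ 2 / 4) ≤ 8 * intBracket ⌊ν⌋ ^ (-2 : ℝ) := by
  have h1 : 1 + ν ^ 2 / 4 ≤ Real.exp (ν ^ 2 / 4) := by
    linarith [Real.add_one_le_exp (ν ^ 2 / 4)]
  have h2 : 0 < 1 + ν ^ 2 / 4 := by positivity
  have hb : intBracket ⌊ν⌋ ^ (-2 : ℝ) = (1 + (⌊ν⌋ : ℝ) ^ 2)⁻¹ := by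
    rw [Real.rpow_neg (intBracket_pos _).le]
    congr 1
    rw [Real.rpow_two]
    exact Real.sq_sqrt (by positivity)
  rw [hb, neg_div, Real.exp_neg, ← div_eq_mul_inv, inv_le_comm₀ (by positivity) (by positivity),
    inv_div]
  refine le_trans ?_ h1
  have hf1 := Int.floor_le ν
  have hf2 := Int.lt_floor_add_one ν
  rw [div_le_iff₀ (by norm_num)]
  nlinarith [sq_nonneg (ν - ⌊ν⌋), sq_nonneg (2 * ν - ⌊ν⌋), sq_nonneg ν]

/-- A row of Schur's test for the Gaussian kernel. -/
theorem sum_mul_exp_neg_sq_le {s : Finset X} {ω w : X → ℝ} (hw : ∀ x, 0 < w x) {K : ℝ}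
    (hK : ∀ μ : ℝ, ∑ x ∈ s with |ω x - μ| ≤ 1, w x ≤ K) (μ : ℝ) :
    ∑ x ∈ s, w x * Real.exp (-(ω x - μ) ^ 2 / 4) ≤
      (8 * ∑' m : ℤ, intBracket m ^ (-2 : ℝ)) * K := by
  have hK0 : 0 ≤ K := (Finset.sum_nonneg fun x _ => (hw x).le).trans (hK 0)
  calc ∑ x ∈ s, w x * Real.exp (-(ω x - μ) ^ 2 / 4)
      ≤ ∑ x ∈ s, w x * (8 * intBracket ⌊ω x - μ⌋ ^ (-2 : ℝ)) :=
        Finset.sum_le_sum fun x _ =>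
          mul_le_mul_of_nonneg_left (exp_neg_sq_div_four_le _) (hw x).le
    _ = ∑ m ∈ s.image (fun x => ⌊ω x - μ⌋), ∑ x ∈ s with ⌊ω x - μ⌋ = m,
          w x * (8 * intBracket ⌊ω x - μ⌋ ^ (-2 : ℝ)) :=
        (Finset.sum_fiberwise_of_maps_to (fun x hx => Finset.mem_image_of_mem _ hx) _).symm
    _ ≤ ∑ m ∈ s.image (fun x => ⌊ω x - μ⌋), intBracket m ^ (-2 : ℝ) * (8 * K) := by
        refine Finset.sum_le_sum fun m _ => ?_
        calc _ = ∑ x ∈ s with ⌊ω x - μ⌋ = m, w x * (8 * intBracket m ^ (-2 : ℝ)) :=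
              Finset.sum_congr rfl fun x hx => by rw [(Finset.mem_filter.1 hx).2]
          _ = (∑ x ∈ s with ⌊ω x - μ⌋ = m, w x) * (8 * intBracket m ^ (-2 : ℝ)) := by
              rw [Finset.sum_mul]
          _ ≤ K * (8 * intBracket m ^ (-2 : ℝ)) := by
              refine mul_le_mul_of_nonneg_right ?_
                (mul_nonneg (by norm_num) (Real.rpow_nonneg (intBracket_pos m).le _))
              refine le_trans (Finset.sum_le_sum_of_subset_of_nonneg ?_
                fun x _ _ => (hw x).le) (hK (μ + m))
              intro x hx
              obtain ⟨hxs, hxm⟩ := Finset.mem_filter.1 hx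
              refine Finset.mem_filter.2 ⟨hxs, ?_⟩
              have h1 := Int.floor_le (ω x - μ)
              have h2 := Int.lt_floor_add_one (ω x - μ)
              rw [hxm] at h1 h2
              rw [abs_le]; constructor <;> linarith
          _ = _ := by ring
    _ = (∑ m ∈ s.image (fun x => ⌊ω x - μ⌋), intBracket m ^ (-2 : ℝ)) * (8 * K) := by
        rw [Finset.sum_mul]
    _ ≤ (∑' m : ℤ, intBracket m ^ (-2 : ℝ)) * (8 * K) := by
        refine mul_le_mul_of_nonneg_right ?_ (by positivity)
        exact (summable_intBracket_rpow_neg (by norm_num)).sum_le_tsum _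
          fun m _ => Real.rpow_nonneg (intBracket_pos m).le _
    _ = _ := by ring

/-- The expansion of the square as a double sum, with a phase linear in `t` in every term. -/
theorem norm_sq_exp_sum_eq (s : Finset X) (a : X → ℂ) (ω : X → ℝ) (t : ℝ) :
    ‖∑ x ∈ s, a x * Complex.exp (-Complex.I * t * ω x)‖ ^ 2 =
      ∑ x ∈ s, ∑ y ∈ s, (a x * (starRingEnd ℂ) (a y) *
        Complex.exp (Complex.I * ((ω y - ω x : ℝ) : ℂ) * t)).re := by
  rw [← Complex.normSq_eq_norm_sq, ← Complex.ofReal_re (Complex.normSq _),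
    ← Complex.mul_conj, map_sum, Finset.sum_mul_sum, Complex.re_sum]
  refine Finset.sum_congr rfl fun x _ => ?_
  rw [Complex.re_sum]
  refine Finset.sum_congr rfl fun y _ => ?_
  congr 1
  rw [map_mul, ← Complex.exp_conj]
  simp only [map_mul, map_neg, Complex.conj_I, Complex.conj_ofReal]
  rw [mul_mul_mul_comm, ← Complex.exp_add]
  congr 2
  push_cast; ring

theorem integral_gaussian_mul_norm_sq_exp_sum (s : Finset X) (a : X → ℂ) (ω : X → ℝ) :
    Integrable (fun t : ℝ => Real.exp (-t ^ 2) *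
      ‖∑ x ∈ s, a x * Complex.exp (-Complex.I * t * ω x)‖ ^ 2) ∧
    ∫ t : ℝ, Real.exp (-t ^ 2) * ‖∑ x ∈ s, a x * Complex.exp (-Complex.I * t * ω x)‖ ^ 2 =
      ∑ x ∈ s, ∑ y ∈ s, (a x * (starRingEnd ℂ) (a y)).re *
        (√π * Real.exp (-(ω y - ω x) ^ 2 / 4)) := by
  have hI : ∀ ν : ℝ, Integrable fun t : ℝ =>
      Complex.exp (Complex.I * (ν : ℂ) * t) * Complex.exp (-1 * (t : ℂ) ^ 2) := by
    intro ν
    have := integrable_cexp_quadratic (b := 1) (by simp) (Complex.I * ν) 0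
    refine this.congr (Eventually.of_forall fun t => ?_)
    simp only
    rw [← Complex.exp_add]; congr 1; ring
  have hterm : ∀ (c : ℂ) (ν t : ℝ), Real.exp (-t ^ 2) * (c * Complex.exp (Complex.I * ν * t)).re =
      (c * (Complex.exp (Complex.I * (ν : ℂ) * t) * Complex.exp (-1 * (t : ℂ) ^ 2))).re := by
    intro c ν t
    have h1 : Complex.exp (-1 * (t : ℂ) ^ 2) = (Real.exp (-t ^ 2) : ℂ) := by
      push_cast; congr 1; ring
    rw [h1, ← mul_assoc, Complex.re_mul_ofReal, mul_comm]
  have hIc : ∀ (c : ℂ) (ν : ℝ), Integrable fun t : ℝ =>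
      Real.exp (-t ^ 2) * (c * Complex.exp (Complex.I * ν * t)).re := by
    intro c ν
    simp only [hterm]
    exact ((hI ν).const_mul c).re
  have hval : ∀ (c : ℂ) (ν : ℝ), ∫ t : ℝ,
      Real.exp (-t ^ 2) * (c * Complex.exp (Complex.I * ν * t)).re =
        c.re * (√π * Real.exp (-ν ^ 2 / 4)) := by
    intro c ν
    simp only [hterm]
    have h2 := integral_re ((hI ν).const_mul c)
    simp only [RCLike.re_eq_complex_re] at h2
    rw [h2, integral_const_mul, fourierIntegral_gaussian (b := 1) (by simp)]
    have h3 : ((π : ℂ) / 1) ^ (1 / 2 : ℂ) = ((√π : ℝ) : ℂ) := by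
      rw [div_one, Real.sqrt_eq_rpow, Complex.ofReal_cpow Real.pi_pos.le]; norm_num
    have h4 : Complex.exp (-(ν : ℂ) ^ 2 / (4 * 1)) = (Real.exp (-ν ^ 2 / 4) : ℂ) := by
      push_cast; congr 1; ring
    rw [h3, h4, ← Complex.ofReal_mul, Complex.re_mul_ofReal]
  simp only [norm_sq_exp_sum_eq, Finset.mul_sum]
  constructor
  · exact integrable_finsetSum _ fun x _ => integrable_finsetSum _ fun y _ => hIc _ _
  · rw [integral_finsetSum _ fun x _ => integrable_finsetSum _ fun y _ => hIc _ _]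
    refine Finset.sum_congr rfl fun x _ => ?_
    rw [integral_finsetSum _ fun y _ => hIc _ _]
    exact Finset.sum_congr rfl fun y _ => hval _ _

/-- Mean value estimate for exponential sums over a unit time interval: if the weights `w` of the
frequencies `ω` in any window of length `2` add up to at most `K`, then the sum is bounded in
`L²([0,1])` by `K` and the weighted `ℓ²` norm of the coefficients. The proof dominates the
indicator of `[0,1]` by a Gaussian and applies Schur's test to the resulting kernel. -/
theorem lintegral_enorm_sq_exp_sum_le (s : Finset X) (a : X → ℂ) {ω w : X → ℝ}
    (hw : ∀ x, 0 < w x) {K : ℝ} (hK : ∀ μ : ℝ, ∑ x ∈ s with |ω x - μ| ≤ 1, w x ≤ K) :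
    ∫⁻ t in Set.Icc (0 : ℝ) 1, ‖∑ x ∈ s, a x * Complex.exp (-Complex.I * t * ω x)‖ₑ ^ 2 ≤
      ENNReal.ofReal (meanValueConst * K * ∑ x ∈ s, ‖a x‖ ^ 2 / w x) := by
  obtain ⟨hint, hval⟩ := integral_gaussian_mul_norm_sq_exp_sum s a ω
  set f : ℝ → ℂ := fun t => ∑ x ∈ s, a x * Complex.exp (-Complex.I * t * ω x) with hf
  have hdom : ∫⁻ t in Set.Icc (0 : ℝ) 1, ‖f t‖ₑ ^ 2 ≤
      ∫⁻ t : ℝ, ENNReal.ofReal (Real.exp 1 * (Real.exp (-t ^ 2) * ‖f t‖ ^ 2)) := by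
    refine (setLIntegral_mono' measurableSet_Icc fun t ht => ?_).trans
      (setLIntegral_le_lintegral _ _)
    rw [← ofReal_norm, ← ENNReal.ofReal_pow (norm_nonneg _)]
    refine ENNReal.ofReal_le_ofReal ?_
    rw [← mul_assoc, ← Real.exp_add]
    refine le_mul_of_one_le_left (by positivity) (Real.one_le_exp ?_)
    nlinarith [ht.1, ht.2]
  refine hdom.trans ?_
  rw [← ofReal_integral_eq_lintegral_ofReal (hint.const_mul _)
    (Eventually.of_forall fun t => by positivity), integral_const_mul, hval]
  refine ENNReal.ofReal_le_ofReal ?_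
  set k : X → X → ℝ := fun x y => Real.exp (-(ω y - ω x) ^ 2 / 4) with hk
  have hk0 : ∀ x y, 0 ≤ k x y := fun x y => (Real.exp_pos _).le
  have hksymm : ∀ x y, k x y = k y x := fun x y => by simp only [hk]; congr 2; ring
  have hschur : ∀ x y, (a x * (starRingEnd ℂ) (a y)).re * (√π * k x y) ≤
      √π / 2 * (‖a x‖ ^ 2 / w x * (w y * k x y)) + √π / 2 * (‖a y‖ ^ 2 / w y * (w x * k y x)) := by
    intro x y
    have hx := hw x
    have hy := hw y
    have h1 : (a x * (starRingEnd ℂ) (a y)).re ≤ ‖a x‖ * ‖a y‖ := by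
      refine (Complex.re_le_norm _).trans ?_
      rw [norm_mul, Complex.norm_conj]
    have h2 : ‖a x‖ * ‖a y‖ ≤ (‖a x‖ ^ 2 / w x * w y + ‖a y‖ ^ 2 / w y * w x) / 2 := by
      have : 0 ≤ (‖a x‖ * w y - ‖a y‖ * w x) ^ 2 / (w x * w y) := by positivity
      have e : (‖a x‖ * w y - ‖a y‖ * w x) ^ 2 / (w x * w y) =
          ‖a x‖ ^ 2 / w x * w y + ‖a y‖ ^ 2 / w y * w x - 2 * (‖a x‖ * ‖a y‖) := by
        field_simp; ring
      linarith
    calc _ ≤ ((‖a x‖ ^ 2 / w x * w y + ‖a y‖ ^ 2 / w y * w x) / 2) * (√π * k x y) :=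
          mul_le_mul_of_nonneg_right (h1.trans h2)
            (mul_nonneg (Real.sqrt_nonneg _) (hk0 x y))
      _ = _ := by rw [hksymm y x]; ring
  have hbound : ∀ x, ∑ y ∈ s, w y * k x y ≤ (8 * ∑' m : ℤ, intBracket m ^ (-2 : ℝ)) * K :=
    fun x => sum_mul_exp_neg_sq_le hw hK (ω x)
  have hhalf : ∑ x ∈ s, ∑ y ∈ s, √π / 2 * (‖a x‖ ^ 2 / w x * (w y * k x y)) ≤
      √π / 2 * (((8 * ∑' m : ℤ, intBracket m ^ (-2 : ℝ)) * K) * ∑ x ∈ s, ‖a x‖ ^ 2 / w x) := by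
    rw [Finset.mul_sum, Finset.mul_sum]
    refine Finset.sum_le_sum fun x _ => ?_
    rw [← Finset.mul_sum, ← Finset.mul_sum]
    refine mul_le_mul_of_nonneg_left ?_ (by positivity)
    rw [mul_comm]
    have := hw x
    exact mul_le_mul_of_nonneg_right (hbound x) (by positivity)
  have htotal : ∑ x ∈ s, ∑ y ∈ s, (a x * (starRingEnd ℂ) (a y)).re * (√π * k x y) ≤
      √π * (((8 * ∑' m : ℤ, intBracket m ^ (-2 : ℝ)) * K) * ∑ x ∈ s, ‖a x‖ ^ 2 / w x) := by
    refine (Finset.sum_le_sum fun x _ => Finset.sum_le_sum fun y _ => hschur x y).trans ?_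
    simp only [Finset.sum_add_distrib]
    rw [Finset.sum_comm (f := fun x y => √π / 2 * (‖a y‖ ^ 2 / w y * (w x * k y x)))]
    linarith
  calc _ ≤ Real.exp 1 * (√π * (((8 * ∑' m : ℤ, intBracket m ^ (-2 : ℝ)) * K) *
        ∑ x ∈ s, ‖a x‖ ^ 2 / w x)) := mul_le_mul_of_nonneg_left htotal (Real.exp_pos _).le
    _ = _ := by rw [meanValueConst]; ring

end Time

/-! ### Fourier coefficients on the torus -/

section Fourier
variable {d k : ℕ}

/-- The total mass `(2π) ^ (2dk)` of `Λ^k × Λ^k`. -/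
noncomputable def configMass (d k : ℕ) : ℝ := (2 * π) ^ (2 * d * k)

theorem configMass_pos (d k : ℕ) : 0 < configMass d k := pow_pos Real.two_pi_pos _

theorem continuous_character (ξ : Freq d k) : Continuous (character ξ) := by
  unfold character
  fun_prop

theorem norm_character (ξ : Freq d k) (x : Config d k) : ‖character ξ x‖ = 1 := by
  simp [character, norm_prod, fourier_apply, Circle.norm_coe]

theorem character_mul_conj (ξ η : Freq d k) (x : Config d k) :
    character ξ x * (starRingEnd ℂ) (character η x) = character (ξ - η) x := by
  simp only [character, map_mul, map_prod, ← fourier_neg, neg_neg]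
  rw [mul_mul_mul_comm]
  simp only [← Finset.prod_mul_distrib, ← fourier_add]
  refine Finset.prod_congr rfl fun j _ => Finset.prod_congr rfl fun a _ => ?_
  have h : -(ξ - η).2 j a = -ξ.2 j a + η.2 j a := by
    simp only [Prod.snd_sub, Pi.sub_apply]; ring
  rw [h]
  rfl

theorem integral_fourier (n : ℤ) :
    ∫ y : AddCircle (2 * π), (fourier n y : ℂ) = if n = 0 then ((2 * π : ℝ) : ℂ) else 0 := by
  split_ifs with h
  · subst h
    simp [Measure.real, AddCircle.measure_univ, Real.pi_pos.le]
  · exact integral_eq_zero_of_add_right_eq_neg (μ := volume)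
      (fourier_add_half_inv_index h Real.two_pi_pos)

theorem integral_prod_fourier (n : Fin k → Fin d → ℤ) :
    ∫ x : Fin k → Torus d, (∏ j, ∏ a, fourier (n j a) (x j a) : ℂ) =
      if n = 0 then (((2 * π) ^ (d * k) : ℝ) : ℂ) else 0 := by
  rw [integral_fintype_prod_volume_eq_prod
    (f := fun j (y : Torus d) => (∏ a, fourier (n j a) (y a) : ℂ))]
  have hj : ∀ j, ∫ y : Torus d, (∏ a, fourier (n j a) (y a) : ℂ) =
      ∏ a, if n j a = 0 then ((2 * π : ℝ) : ℂ) else 0 := fun j => by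
    rw [integral_fintype_prod_volume_eq_prod
      (f := fun a (y : AddCircle (2 * π)) => (fourier (n j a) y : ℂ))]
    simp only [integral_fourier]
  simp only [hj]
  split_ifs with h
  · subst h
    simp [pow_mul]
  · obtain ⟨j, hj⟩ := Function.ne_iff.1 h
    obtain ⟨a, ha⟩ := Function.ne_iff.1 hj
    refine Finset.prod_eq_zero (Finset.mem_univ j) (Finset.prod_eq_zero (Finset.mem_univ a) ?_)
    rw [if_neg]
    simpa using ha

theorem integral_character (ξ : Freq d k) :
    ∫ x, character ξ x = if ξ = 0 then (configMass d k : ℂ) else 0 := by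
  simp only [character]
  rw [Measure.volume_eq_prod, integral_prod_mul
    (f := fun x : Fin k → Torus d => (∏ j, ∏ a, fourier (ξ.1 j a) (x j a) : ℂ))
    (g := fun x : Fin k → Torus d => (∏ j, ∏ a, fourier (-(ξ.2 j a)) (x j a) : ℂ)),
    integral_prod_fourier ξ.1, integral_prod_fourier fun j a => -(ξ.2 j a)]
  have h2 : ((fun j a => -(ξ.2 j a)) = 0) ↔ ξ.2 = 0 := by
    rw [← neg_eq_zero (a := ξ.2)]; rfl
  by_cases h : ξ = 0
  · rw [if_pos h, if_pos (by rw [h]; rfl), if_pos (h2.2 (by rw [h]; rfl)), ← Complex.ofReal_mul,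
      ← pow_add, configMass]
    congr 2; ring
  · rw [if_neg h]
    by_cases h1 : ξ.1 = 0
    · rw [if_neg fun h3 => h (Prod.ext h1 (h2.1 h3)), mul_zero]
    · rw [if_neg h1, zero_mul]

theorem memLp_character (ξ : Freq d k) (p : ℝ≥0∞) : MemLp (character ξ) p volume :=
  MemLp.of_bound (continuous_character ξ).aestronglyMeasurable 1
    (Eventually.of_forall fun x => (norm_character ξ x).le)

theorem memLp_sum_character {X : Type*} (F : Finset X) (c : X → ℂ) (ρ : X → Freq d k)
    (p : ℝ≥0∞) : MemLp (fun x => ∑ i ∈ F, c i * character (ρ i) x) p volume :=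
  memLp_finsetSum _ fun i _ => (memLp_character (ρ i) p).const_mul (c i)

theorem fourierTransform_character (ξ η : Freq d k) :
    fourierTransform (character ξ) η = if ξ = η then (configMass d k : ℂ) else 0 := by
  simp only [fourierTransform, character_mul_conj, integral_character, sub_eq_zero]

theorem integrable_mul_conj_character {γ : Config d k → ℂ} (hγ : MemLp γ 2 volume)
    (ξ : Freq d k) : Integrable fun x => γ x * (starRingEnd ℂ) (character ξ x) := by
  refine (hγ.integrable one_le_two).mul_bdd (c := 1) ?_ ?_
  · exact (Complex.continuous_conj.comp (continuous_character ξ)).aestronglyMeasurable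
  · exact Eventually.of_forall fun x => by
      rw [RCLike.norm_conj, norm_character]

theorem fourierTransform_sub {γ γ' : Config d k → ℂ} (hγ : MemLp γ 2 volume)
    (hγ' : MemLp γ' 2 volume) (ξ : Freq d k) :
    fourierTransform (fun x => γ x - γ' x) ξ = fourierTransform γ ξ - fourierTransform γ' ξ := by
  simp only [fourierTransform, sub_mul]
  exact integral_sub (integrable_mul_conj_character hγ ξ) (integrable_mul_conj_character hγ' ξ)

open scoped Classical in
theorem fourierTransform_sum_character {X : Type*} (F : Finset X) (c : X → ℂ)
    (ρ : X → Freq d k) (η : Freq d k) :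
    fourierTransform (fun x => ∑ i ∈ F, c i * character (ρ i) x) η =
      configMass d k * ∑ i ∈ F with ρ i = η, c i := by
  have h : ∀ i, fourierTransform (fun x => c i * character (ρ i) x) η =
      c i * fourierTransform (character (ρ i)) η := by
    intro i
    simp only [fourierTransform, mul_assoc]
    exact integral_const_mul _ _
  have hs : fourierTransform (fun x => ∑ i ∈ F, c i * character (ρ i) x) η =
      ∑ i ∈ F, fourierTransform (fun x => c i * character (ρ i) x) η := by
    simp only [fourierTransform, Finset.sum_mul]
    exact integral_finsetSum _ fun i _ =>
      integrable_mul_conj_character ((memLp_character (ρ i) 2).const_mul (c i)) η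
  rw [hs, Finset.sum_filter, Finset.mul_sum]
  refine Finset.sum_congr rfl fun i _ => ?_
  rw [h, fourierTransform_character]
  split_ifs <;> ring

/-- The characters as elements of `L²`, normalised to have norm `1`. -/
noncomputable def characterLp (ξ : Freq d k) : Lp ℂ 2 (volume : Measure (Config d k)) :=
  (((√(configMass d k))⁻¹ : ℝ) : ℂ) • (memLp_character ξ 2).toLp

theorem inner_toLp_character {γ : Config d k → ℂ} (hγ : MemLp γ 2 volume) (ξ : Freq d k) :
    inner ℂ ((memLp_character ξ 2).toLp) (hγ.toLp) = fourierTransform γ ξ := by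
  rw [L2.inner_def, fourierTransform]
  refine integral_congr_ae ?_
  filter_upwards [(memLp_character ξ 2).coeFn_toLp, hγ.coeFn_toLp] with x h1 h2
  rw [h1, h2, RCLike.inner_apply]

theorem inner_characterLp {γ : Config d k → ℂ} (hγ : MemLp γ 2 volume) (ξ : Freq d k) :
    inner ℂ (characterLp ξ) (hγ.toLp) =
      (((√(configMass d k))⁻¹ : ℝ) : ℂ) * fourierTransform γ ξ := by
  rw [characterLp, inner_smul_left, inner_toLp_character, Complex.conj_ofReal]

theorem orthonormal_characterLp : Orthonormal ℂ (characterLp (d := d) (k := k)) := by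
  classical
  rw [orthonormal_iff_ite]
  intro ξ η
  have hV := configMass_pos d k
  have hη : characterLp η = (((√(configMass d k))⁻¹ : ℝ) : ℂ) • (memLp_character η 2).toLp := rfl
  rw [hη, inner_smul_right, inner_characterLp, fourierTransform_character]
  by_cases h : ξ = η
  · rw [if_pos h.symm, if_pos h, ← Complex.ofReal_mul, ← Complex.ofReal_mul,
      ← Complex.ofReal_one]
    congr 1
    rw [← mul_assoc, ← mul_inv, Real.mul_self_sqrt hV.le, inv_mul_cancel₀ hV.ne']
  · rw [if_neg (Ne.symm h), if_neg h, mul_zero, mul_zero]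

/-- Bessel's inequality. -/
theorem sum_norm_sq_fourierTransform_le {γ : Config d k → ℂ} (hγ : MemLp γ 2 volume)
    (F : Finset (Freq d k)) :
    ∑ ξ ∈ F, ‖fourierTransform γ ξ‖ ^ 2 ≤ configMass d k * (eLpNorm γ 2 volume).toReal ^ 2 := by
  have h := orthonormal_characterLp.sum_inner_products_le (x := hγ.toLp) (s := F)
  have hV := configMass_pos d k
  rw [Lp.norm_toLp] at h
  rw [← inv_mul_le_iff₀ hV, Finset.mul_sum]
  refine le_of_eq_of_le (Finset.sum_congr rfl fun ξ _ => ?_) h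
  rw [inner_characterLp, norm_mul, Complex.norm_real, mul_pow, norm_inv, inv_pow, Real.norm_eq_abs,
    sq_abs, Real.sq_sqrt hV.le]

theorem summable_norm_sq_fourierTransform {γ : Config d k → ℂ} (hγ : MemLp γ 2 volume) :
    Summable fun ξ => ‖fourierTransform γ ξ‖ ^ 2 :=
  summable_of_sum_le (fun _ => sq_nonneg _) (sum_norm_sq_fourierTransform_le hγ)

theorem tsum_norm_sq_fourierTransform_le {γ : Config d k → ℂ} (hγ : MemLp γ 2 volume) :
    ∑' ξ, ‖fourierTransform γ ξ‖ ^ 2 ≤ configMass d k * (eLpNorm γ 2 volume).toReal ^ 2 :=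
  (summable_norm_sq_fourierTransform hγ).tsum_le_of_sum_le (sum_norm_sq_fourierTransform_le hγ)

theorem enorm_sq_fourierTransform_le {γ : Config d k → ℂ} (hγ : MemLp γ 2 volume)
    (ξ : Freq d k) : ‖fourierTransform γ ξ‖ₑ ^ 2 ≤
      ENNReal.ofReal (configMass d k) * eLpNorm γ 2 volume ^ 2 := by
  have h := sum_norm_sq_fourierTransform_le hγ {ξ}
  rw [Finset.sum_singleton] at h
  rw [← ofReal_norm, ← ENNReal.ofReal_pow (norm_nonneg _), ← ENNReal.ofReal_toReal hγ.2.ne,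
    ← ENNReal.ofReal_pow ENNReal.toReal_nonneg, ← ENNReal.ofReal_mul (configMass_pos d k).le]
  exact ENNReal.ofReal_le_ofReal h

theorem tendsto_fourierTransform {ι : Type*} {l : Filter ι} {g : ι → Config d k → ℂ}
    {γ : Config d k → ℂ} (hg : ∀ i, MemLp (g i) 2 volume) (hγ : MemLp γ 2 volume)
    (h : Tendsto (fun i => eLpNorm (fun x => g i x - γ x) 2 volume) l (𝓝 0)) (ξ : Freq d k) :
    Tendsto (fun i => fourierTransform (g i) ξ) l (𝓝 (fourierTransform γ ξ)) := by
  rw [tendsto_iff_edist_tendsto_0]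
  have h1 : Tendsto (fun i => ENNReal.ofReal (configMass d k) *
      eLpNorm (fun x => g i x - γ x) 2 volume ^ 2) l (𝓝 0) := by
    have := ENNReal.Tendsto.const_mul (a := ENNReal.ofReal (configMass d k))
      (((ENNReal.continuous_pow 2).tendsto 0).comp h) (Or.inr ENNReal.ofReal_ne_top)
    simpa using this
  have h2 : Tendsto (fun i => edist (fourierTransform (g i) ξ) (fourierTransform γ ξ) ^ 2) l
      (𝓝 0) := by
    refine tendsto_of_tendsto_of_tendsto_of_le_of_le tendsto_const_nhds h1
      (fun _ => zero_le) fun i => ?_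
    simp only
    rw [edist_eq_enorm_sub, ← fourierTransform_sub (hg i) hγ]
    exact enorm_sq_fourierTransform_le ((hg i).sub hγ) ξ
  have h3 := (ENNReal.continuous_rpow_const (y := 1 / 2)).tendsto 0 |>.comp h2
  rw [ENNReal.zero_rpow_of_pos (by norm_num)] at h3
  refine h3.congr fun i => ?_
  simp only [Function.comp]
  rw [← ENNReal.rpow_natCast, ← ENNReal.rpow_mul]
  norm_num

open scoped Classical in
/-- Parseval's identity for trigonometric polynomials whose frequencies may repeat. -/
theorem lintegral_enorm_sq_sum_character {X : Type*} (F : Finset X) (c : X → ℂ)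
    (ρ : X → Freq d k) :
    ∫⁻ x, ‖∑ i ∈ F, c i * character (ρ i) x‖ₑ ^ 2 = ENNReal.ofReal (configMass d k) *
      ∑ η ∈ F.image ρ, ‖∑ i ∈ F with ρ i = η, c i‖ₑ ^ 2 := by
  have hV := configMass_pos d k
  have hmem := memLp_sum_character F c ρ 2
  rw [← eLpNorm_two_sq volume fun x => ∑ i ∈ F, c i * character (ρ i) x,
    ← ENNReal.ofReal_toReal hmem.2.ne, ← Lp.norm_toLp _ hmem]
  have hb : hmem.toLp = ∑ η ∈ F.image ρ,
      ((√(configMass d k) : ℝ) * ∑ i ∈ F with ρ i = η, c i : ℂ) • characterLp η := by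
    refine Lp.ext ?_
    have h1 : ∀ᵐ x, ∀ η ∈ F.image ρ, characterLp η x =
        (((√(configMass d k))⁻¹ : ℝ) : ℂ) * character η x := by
      refine (Filter.eventually_all_finset _).2 fun η _ => ?_
      filter_upwards [Lp.coeFn_smul (((√(configMass d k))⁻¹ : ℝ) : ℂ)
        ((memLp_character η 2).toLp), (memLp_character η 2).coeFn_toLp] with x h1 h2
      rw [characterLp, h1, Pi.smul_apply, h2, smul_eq_mul]
    have h2 : ∀ᵐ x, ∀ η ∈ F.image ρ,
        (((√(configMass d k) : ℝ) * ∑ i ∈ F with ρ i = η, c i : ℂ) • characterLp η : Lp ℂ 2 _) x =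
        ((√(configMass d k) : ℝ) * ∑ i ∈ F with ρ i = η, c i : ℂ) • characterLp η x :=
      (Filter.eventually_all_finset _).2 fun η _ => Lp.coeFn_smul _ _
    filter_upwards [hmem.coeFn_toLp, Lp.coeFn_finsetSum (F.image ρ) fun η =>
      ((√(configMass d k) : ℝ) * ∑ i ∈ F with ρ i = η, c i : ℂ) • characterLp η, h1, h2]
      with x e1 e2 e3 e4
    rw [e1, e2, Finset.sum_apply,
      ← Finset.sum_fiberwise_of_maps_to (fun i hi => Finset.mem_image_of_mem ρ hi)]
    refine Finset.sum_congr rfl fun η hη => ?_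
    rw [e4 η hη, e3 η hη, smul_eq_mul]
    have hs : ((√(configMass d k) : ℝ) : ℂ) * (((√(configMass d k))⁻¹ : ℝ) : ℂ) = 1 := by
      rw [← Complex.ofReal_mul, mul_inv_cancel₀ (Real.sqrt_pos.2 hV).ne', Complex.ofReal_one]
    have : ∀ i ∈ F.filter (fun i => ρ i = η), c i * character (ρ i) x = c i * character η x :=
      fun i hi => by rw [(Finset.mem_filter.1 hi).2]
    rw [Finset.sum_congr rfl this, ← Finset.sum_mul]
    linear_combination (-(∑ i ∈ F with ρ i = η, c i) * character η x) * hs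
  have hn : ‖hmem.toLp‖ ^ 2 = configMass d k *
      ∑ η ∈ F.image ρ, ‖∑ i ∈ F with ρ i = η, c i‖ ^ 2 := by
    rw [hb, ← inner_self_eq_norm_sq (𝕜 := ℂ), orthonormal_characterLp.inner_sum, map_sum,
      Finset.mul_sum]
    refine Finset.sum_congr rfl fun η _ => ?_
    rw [RCLike.conj_mul, ← RCLike.ofReal_pow, RCLike.ofReal_re, norm_mul, mul_pow,
      Complex.norm_real, Real.norm_eq_abs, sq_abs, Real.sq_sqrt hV.le]
  rw [← ENNReal.ofReal_pow (norm_nonneg _), hn, ENNReal.ofReal_mul hV.le,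
    ENNReal.ofReal_sum_of_nonneg fun _ _ => sq_nonneg _]
  congr 1
  refine Finset.sum_congr rfl fun η _ => ?_
  rw [ENNReal.ofReal_pow (norm_nonneg _), ofReal_norm]

end Fourier

/-! ### The collision operator on the Fourier side -/

section CollisionFreq
variable {d k : ℕ}

/-- The frequency of the restriction of `character ξ` by `B⁺_{j,k+1}`: the last two frequencies
`ξ_{k+1}` and `ξ'_{k+1}` are transferred to the `j`-th one. -/
def gainFreq (j : Fin k) (ξ : Freq d (k + 1)) : Freq d k :=
  (fun i a => ξ.1 i.castSucc a + if i = j then ξ.1 (Fin.last k) a - ξ.2 (Fin.last k) a else 0,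
    fun i => ξ.2 i.castSucc)

/-- The frequency of the restriction of `character ξ` by `B⁻_{j,k+1}`, where the roles of the
primed and unprimed frequencies are exchanged. -/
def lossFreq (j : Fin k) (ξ : Freq d (k + 1)) : Freq d k := (gainFreq j ξ.swap).swap

theorem character_swap (ξ : Freq d k) (x : Config d k) :
    character ξ.swap x.swap = (starRingEnd ℂ) (character ξ x) := by
  simp only [character, map_mul, map_prod, ← fourier_neg, neg_neg, Prod.fst_swap, Prod.snd_swap]
  rw [mul_comm]

theorem character_snoc (j : Fin k) (ξ : Freq d (k + 1)) (x : Config d k) :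
    character ξ (Fin.snoc (α := fun _ => Torus d) x.1 (x.1 j),
      Fin.snoc (α := fun _ => Torus d) x.2 (x.1 j)) = character (gainFreq j ξ) x := by
  simp only [character, gainFreq, Fin.prod_univ_castSucc, Fin.snoc_castSucc, Fin.snoc_last,
    fourier_add, Finset.prod_mul_distrib]
  have h : ∏ i, ∏ a, (fourier (if i = j then ξ.1 (Fin.last k) a - ξ.2 (Fin.last k) a else 0)
      (x.1 i a) : ℂ) = (∏ a, (fourier (ξ.1 (Fin.last k) a) (x.1 j a) : ℂ)) *
        ∏ a, (fourier (-ξ.2 (Fin.last k) a) (x.1 j a) : ℂ) := by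
    rw [Finset.prod_eq_single j, ← Finset.prod_mul_distrib]
    · refine Finset.prod_congr rfl fun a _ => ?_
      rw [if_pos rfl, sub_eq_add_neg, fourier_add]
    · intro i _ hi
      exact Finset.prod_eq_one fun a _ => by rw [if_neg hi, fourier_zero]
    · simp
  rw [h]
  ring

theorem collision_character (j : Fin k) (ξ : Freq d (k + 1)) (x : Config d k) :
    collision j (character ξ) x = character (gainFreq j ξ) x - character (lossFreq j ξ) x := by
  rw [collision, character_snoc]
  congr 1
  have h := character_snoc j ξ.swap x.swap
  have h1 := character_swap ξ (Fin.snoc (α := fun _ => Torus d) x.1 (x.2 j),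
    Fin.snoc (α := fun _ => Torus d) x.2 (x.2 j))
  have h2 := character_swap (lossFreq j ξ) x
  have h3 := h1.symm.trans (h.trans h2)
  exact (starRingEnd ℂ).injective h3

theorem collision_sum_character {X : Type*} (j : Fin k) (F : Finset X) (c : X → ℂ)
    (e : X → Freq d (k + 1)) (x : Config d k) :
    collision j (fun y => ∑ i ∈ F, c i * character (e i) y) x =
      ∑ i ∈ F, (c i * character (gainFreq j (e i)) x - c i * character (lossFreq j (e i)) x) := by
  simp only [← mul_sub, ← collision_character]
  simp only [collision, mul_sub, Finset.sum_sub_distrib]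

/-- The symbol `∏ⱼ ⟨ξⱼ⟩^α ∏ⱼ ⟨ξ'ⱼ⟩^α` of `S^{(k,α)}`. -/
noncomputable def bracketSymbol (α : ℝ) (ξ : Freq d k) : ℝ :=
  (∏ j, japaneseBracket (ξ.1 j) ^ α) * ∏ j, japaneseBracket (ξ.2 j) ^ α

/-- The symbol `∑ⱼ Q(ξⱼ) - ∑ⱼ Q(ξ'ⱼ)` of the free Hamiltonian. -/
noncomputable def phase (θ : Fin d → ℝ) (ξ : Freq d k) : ℝ :=
  ∑ j, quadForm θ (ξ.1 j) - ∑ j, quadForm θ (ξ.2 j)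

theorem bracketSymbol_swap (α : ℝ) (ξ : Freq d k) :
    bracketSymbol α ξ.swap = bracketSymbol α ξ := mul_comm _ _

theorem phase_swap (θ : Fin d → ℝ) (ξ : Freq d k) : phase θ ξ.swap = -phase θ ξ := by
  simp [phase]

theorem bracketSymbol_pos (α : ℝ) (ξ : Freq d k) : 0 < bracketSymbol α ξ :=
  mul_pos (Finset.prod_pos fun _ _ => Real.rpow_pos_of_pos (japaneseBracket_pos _) _)
    (Finset.prod_pos fun _ _ => Real.rpow_pos_of_pos (japaneseBracket_pos _) _)

section Fiber
variable (j : Fin k) (ξ : Freq d (k + 1))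

theorem gainFreq_fst_self : (gainFreq j ξ).1 j =
    ξ.1 j.castSucc + (ξ.1 (Fin.last k) - ξ.2 (Fin.last k)) := by
  funext a; simp [gainFreq]

theorem gainFreq_fst_of_ne {i : Fin k} (h : i ≠ j) : (gainFreq j ξ).1 i = ξ.1 i.castSucc := by
  funext a; simp [gainFreq, h]

theorem fst_castSucc_eq : ξ.1 j.castSucc =
    (gainFreq j ξ).1 j - ξ.1 (Fin.last k) + ξ.2 (Fin.last k) := by
  rw [gainFreq_fst_self]; abel

/-- A frequency is determined by its image under `gainFreq` and its two last entries. -/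
theorem gainFreq_injOn {ξ ξ' : Freq d (k + 1)} (h : gainFreq j ξ = gainFreq j ξ')
    (h1 : ξ.1 (Fin.last k) = ξ'.1 (Fin.last k)) (h2 : ξ.2 (Fin.last k) = ξ'.2 (Fin.last k)) :
    ξ = ξ' := by
  refine Prod.ext ?_ ?_
  · funext i
    refine Fin.lastCases h1 (fun i => ?_) i
    by_cases hi : i = j
    · subst hi
      rw [fst_castSucc_eq, fst_castSucc_eq, h, h1, h2]
    · rw [← gainFreq_fst_of_ne j ξ hi, ← gainFreq_fst_of_ne j ξ' hi, h]
  · funext i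
    refine Fin.lastCases h2 (fun i => ?_) i
    exact congrFun (congrArg Prod.snd h) i

/-- The factor of the symbol coming from the particles not involved in the collision. -/
noncomputable def spectatorSymbol (α : ℝ) : ℝ :=
  (∏ i ∈ Finset.univ.erase j, japaneseBracket (ξ.1 i.castSucc) ^ α) *
    ∏ i : Fin k, japaneseBracket (ξ.2 i.castSucc) ^ α

theorem one_le_spectatorSymbol {α : ℝ} (hα : 0 ≤ α) : 1 ≤ spectatorSymbol j ξ α := by
  have h : ∀ x : Fin d → ℤ, 1 ≤ japaneseBracket x ^ α := fun x =>
    Real.one_le_rpow (one_le_japaneseBracket x) hα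
  exact one_le_mul_of_one_le_of_one_le (Finset.one_le_prod fun i _ => h _)
    (Finset.one_le_prod fun i _ => h _)

theorem bracketSymbol_succ (α : ℝ) : bracketSymbol α ξ = spectatorSymbol j ξ α *
    (japaneseBracket (ξ.1 j.castSucc) ^ α * (japaneseBracket (ξ.1 (Fin.last k)) ^ α *
      japaneseBracket (ξ.2 (Fin.last k)) ^ α)) := by
  rw [bracketSymbol, spectatorSymbol, Fin.prod_univ_castSucc, Fin.prod_univ_castSucc,
    ← Finset.mul_prod_erase Finset.univ (fun i : Fin k => japaneseBracket (ξ.1 i.castSucc) ^ α)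
      (Finset.mem_univ j)]
  ring

theorem bracketSymbol_gainFreq (α : ℝ) : bracketSymbol α (gainFreq j ξ) =
    spectatorSymbol j ξ α * japaneseBracket ((gainFreq j ξ).1 j) ^ α := by
  rw [bracketSymbol, spectatorSymbol,
    ← Finset.mul_prod_erase Finset.univ (fun i : Fin k => japaneseBracket ((gainFreq j ξ).1 i) ^ α)
      (Finset.mem_univ j)]
  have : ∀ i ∈ Finset.univ.erase j, japaneseBracket ((gainFreq j ξ).1 i) ^ α =
      japaneseBracket (ξ.1 i.castSucc) ^ α := fun i hi => by
    rw [gainFreq_fst_of_ne j ξ (Finset.ne_of_mem_erase hi)]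
  rw [Finset.prod_congr rfl this, mul_comm (japaneseBracket _ ^ α), mul_right_comm]
  rfl

theorem phase_eq (θ : Fin d → ℝ) : phase θ ξ =
    quadForm θ ((gainFreq j ξ).1 j - ξ.1 (Fin.last k) + ξ.2 (Fin.last k)) +
      quadForm θ (ξ.1 (Fin.last k)) - quadForm θ (ξ.2 (Fin.last k)) +
      (∑ i ∈ Finset.univ.erase j, quadForm θ ((gainFreq j ξ).1 i) -
        ∑ i, quadForm θ ((gainFreq j ξ).2 i)) := by
  rw [phase, Fin.sum_univ_castSucc, Fin.sum_univ_castSucc,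
    ← Finset.add_sum_erase Finset.univ (fun i : Fin k => quadForm θ (ξ.1 i.castSucc))
      (Finset.mem_univ j), ← fst_castSucc_eq]
  have : ∀ i ∈ Finset.univ.erase j, quadForm θ ((gainFreq j ξ).1 i) =
      quadForm θ (ξ.1 i.castSucc) := fun i hi => by
    rw [gainFreq_fst_of_ne j ξ (Finset.ne_of_mem_erase hi)]
  rw [Finset.sum_congr rfl this]
  have h2 : ∑ i, quadForm θ ((gainFreq j ξ).2 i) = ∑ i : Fin k, quadForm θ (ξ.2 i.castSucc) := rfl
  rw [h2]
  ring

end Fiber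

theorem rpow_neg_two_mul {x : ℝ} (hx : 0 < x) (α : ℝ) : x ^ (-(2 * α)) = ((x ^ α) ^ 2)⁻¹ := by
  rw [Real.rpow_neg hx.le, ← Real.rpow_natCast, ← Real.rpow_mul hx.le]
  congr 2; push_cast; ring

theorem rpow_two_mul {x : ℝ} (hx : 0 < x) (α : ℝ) : x ^ (2 * α) = (x ^ α) ^ 2 := by
  rw [← Real.rpow_natCast, ← Real.rpow_mul hx.le]
  congr 1; push_cast; ring

end CollisionFreq

/-- A bound of the sums over the fibers of the frequency map `ρ`, which is a finite-sum version of
the boundedness of the trace in `L²`. -/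
def TraceBound {X Y : Type*} (ρ : X → Y) (W : X → ℝ) (C : ℝ) : Prop :=
  ∀ s : Finset X, (∀ x ∈ s, ∀ y ∈ s, ρ x = ρ y) → ∑ x ∈ s, (W x ^ 2)⁻¹ ≤ C

/-- A bound of the sums over those parts of the fibers of the frequency map `ρ` which are resonant,
that is, on which the phase `ω` lies in a given window. -/
def ResonanceBound {X Y : Type*} (ρ : X → Y) (ω : X → ℝ) (W : X → ℝ) (v : Y → ℝ) (C : ℝ) : Prop :=
  ∀ s : Finset X, (∀ x ∈ s, ∀ y ∈ s, ρ x = ρ y) →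
    ∀ μ : ℝ, ∑ x ∈ s with |ω x - μ| ≤ 1, v (ρ x) ^ 2 / W x ^ 2 ≤ C

theorem sum_le_of_tsum_le {X Y : Type*} {s : Finset X} {f : X → ℝ} {g : Y → ℝ} {C : ℝ≥0∞}
    (hC : C ≠ ⊤) {P : Y → Prop} [DecidablePred P]
    (φ : X → Y) (hφ : ∀ x ∈ s, ∀ y ∈ s, φ x = φ y → x = y)
    (hP : ∀ x ∈ s, P (φ x)) (hf : ∀ x ∈ s, f x ≤ g (φ x)) (hg : ∀ y, 0 ≤ g y)
    (h : ∑' y, (if P y then ENNReal.ofReal (g y) else 0) ≤ C) : ∑ x ∈ s, f x ≤ C.toReal := by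
  classical
  refine (Finset.sum_le_sum hf).trans ?_
  rw [← ENNReal.ofReal_le_ofReal_iff ENNReal.toReal_nonneg, ENNReal.ofReal_toReal hC,
    ENNReal.ofReal_sum_of_nonneg fun x _ => hg _]
  refine le_trans ?_ h
  have h1 : ∑ x ∈ s, ENNReal.ofReal (g (φ x)) =
      ∑ y ∈ s.image φ, if P y then ENNReal.ofReal (g y) else 0 := by
    rw [Finset.sum_image fun x hx y hy => hφ x hx y hy]
    exact Finset.sum_congr rfl fun x hx => by rw [if_pos (hP x hx)]
  rw [h1]
  exact ENNReal.sum_le_tsum _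

theorem exists_traceBound_gainFreq {α : ℝ} (hα : 1 < α) : ∃ C : ℝ, 0 ≤ C ∧
    ∀ (k : ℕ) (j : Fin k), TraceBound (gainFreq (d := 3) j) (bracketSymbol α) C := by
  obtain ⟨C, hC, h⟩ := exists_tsum_trace_le hα
  refine ⟨C.toReal, ENNReal.toReal_nonneg, fun k j s hs => ?_⟩
  rcases s.eq_empty_or_nonempty with rfl | ⟨ξ₀, hξ₀⟩
  · simp
  refine sum_le_of_tsum_le hC (P := fun _ => True)
    (g := fun p : (Fin 3 → ℤ) × (Fin 3 → ℤ) =>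
      japaneseBracket ((gainFreq j ξ₀).1 j - p.1 + p.2) ^ (-(2 * α)) *
          (japaneseBracket p.1 ^ (-(2 * α)) * japaneseBracket p.2 ^ (-(2 * α))))
    (fun ξ => (ξ.1 (Fin.last k), ξ.2 (Fin.last k))) ?_ (fun _ _ => trivial) ?_ ?_ ?_
  · intro ξ hξ ξ' hξ' heq
    exact gainFreq_injOn j (hs _ hξ _ hξ') (congrArg Prod.fst heq) (congrArg Prod.snd heq)
  · intro ξ hξ
    simp only
    rw [hs ξ₀ hξ₀ ξ hξ, ← fst_castSucc_eq, rpow_neg_two_mul (japaneseBracket_pos _),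
      rpow_neg_two_mul (japaneseBracket_pos _), rpow_neg_two_mul (japaneseBracket_pos _),
      ← mul_inv, ← mul_inv, ← mul_pow, ← mul_pow, bracketSymbol_succ j]
    have h1 := one_le_spectatorSymbol j ξ (α := α) (by linarith)
    have h2 : ∀ x : Fin 3 → ℤ, 0 < japaneseBracket x ^ α := fun x =>
      Real.rpow_pos_of_pos (japaneseBracket_pos _) _
    have h3 := mul_pos (h2 (ξ.1 j.castSucc))
      (mul_pos (h2 (ξ.1 (Fin.last k))) (h2 (ξ.2 (Fin.last k))))
    refine inv_anti₀ (by positivity) ?_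
    exact pow_le_pow_left₀ h3.le (le_mul_of_one_le_left h3.le h1) 2
  · intro p
    have h2 : ∀ x : Fin 3 → ℤ, 0 ≤ japaneseBracket x ^ (-(2 * α)) := fun x =>
      Real.rpow_nonneg (japaneseBracket_pos _).le _
    exact mul_nonneg (h2 _) (mul_nonneg (h2 _) (h2 _))
  · simpa using h ((gainFreq j ξ₀).1 j)

theorem exists_resonanceBound_gainFreq {α : ℝ} (hα : 1 < α) {θ : Fin 3 → ℝ}
    (hθ : ∀ a, 0 < θ a) : ∃ C : ℝ, 0 ≤ C ∧ ∀ (k : ℕ) (j : Fin k),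
      ResonanceBound (gainFreq (d := 3) j) (phase θ) (bracketSymbol α) (bracketSymbol α) C := by
  obtain ⟨C, hC, h⟩ := exists_tsum_resonance_le hα hθ
  refine ⟨C.toReal, ENNReal.toReal_nonneg, fun k j s hs μ => ?_⟩
  rcases s.eq_empty_or_nonempty with rfl | ⟨ξ₀, hξ₀⟩
  · simp
  set n := (gainFreq j ξ₀).1 j with hn
  set c := ∑ i ∈ Finset.univ.erase j, quadForm θ ((gainFreq j ξ₀).1 i) -
        ∑ i, quadForm θ ((gainFreq j ξ₀).2 i) with hc
  refine sum_le_of_tsum_le hC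
    (φ := fun ξ => (ξ.1 (Fin.last k), ξ.2 (Fin.last k))) ?_ ?_ ?_ ?_ (h n (μ - c))
  · intro ξ hξ ξ' hξ' heq
    exact gainFreq_injOn j (hs _ (Finset.mem_filter.1 hξ).1 _ (Finset.mem_filter.1 hξ').1)
      (congrArg Prod.fst heq) (congrArg Prod.snd heq)
  · intro ξ hξ
    obtain ⟨hξs, hξμ⟩ := Finset.mem_filter.1 hξ
    rw [phase_eq j, ← hs ξ₀ hξ₀ ξ hξs, ← hc, ← hn] at hξμ
    refine le_of_eq_of_le ?_ hξμ
    congr 1; ring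
  · intro ξ hξ
    obtain ⟨hξs, -⟩ := Finset.mem_filter.1 hξ
    simp only
    have hnξ : n = (gainFreq j ξ).1 j := by rw [hn, hs ξ₀ hξ₀ ξ hξs]
    rw [hnξ, ← fst_castSucc_eq, rpow_neg_two_mul (japaneseBracket_pos _),
      rpow_neg_two_mul (japaneseBracket_pos _), rpow_neg_two_mul (japaneseBracket_pos _),
      rpow_two_mul (japaneseBracket_pos _), bracketSymbol_gainFreq, bracketSymbol_succ j]
    have h1 := one_pos.trans_le (one_le_spectatorSymbol j ξ (α := α) (by linarith))
    have h2 : ∀ x : Fin 3 → ℤ, 0 < japaneseBracket x ^ α := fun x =>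
      Real.rpow_pos_of_pos (japaneseBracket_pos _) _
    have e1 := h2 (ξ.1 j.castSucc)
    have e2 := h2 (ξ.1 (Fin.last k))
    have e3 := h2 (ξ.2 (Fin.last k))
    refine le_of_eq ?_
    field_simp
  · intro p
    have h2 : ∀ x : Fin 3 → ℤ, 0 ≤ japaneseBracket x ^ (-(2 * α)) := fun x =>
      Real.rpow_nonneg (japaneseBracket_pos _).le _
    exact mul_nonneg (Real.rpow_nonneg (japaneseBracket_pos _).le _)
      (mul_nonneg (h2 _) (mul_nonneg (h2 _) (h2 _)))

theorem TraceBound.lossFreq {d k : ℕ} {α C : ℝ} {j : Fin k}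
    (h : TraceBound (gainFreq (d := d) j) (bracketSymbol α) C) :
    TraceBound (lossFreq (d := d) j) (bracketSymbol α) C := by
  intro s hs
  have h1 := h (s.map (Equiv.prodComm _ _).toEmbedding) ?_
  · rw [Finset.sum_map] at h1
    simpa only [Equiv.coe_toEmbedding, Equiv.prodComm_apply, bracketSymbol_swap] using h1
  · intro x hx y hy
    obtain ⟨x', hx', rfl⟩ := Finset.mem_map.1 hx
    obtain ⟨y', hy', rfl⟩ := Finset.mem_map.1 hy
    exact Prod.swap_injective (hs x' hx' y' hy')

theorem ResonanceBound.lossFreq {d k : ℕ} {α C : ℝ} {j : Fin k} {θ : Fin d → ℝ}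
    (h : ResonanceBound (gainFreq (d := d) j) (phase θ) (bracketSymbol α) (bracketSymbol α) C) :
    ResonanceBound (lossFreq (d := d) j) (phase θ) (bracketSymbol α) (bracketSymbol α) C := by
  intro s hs μ
  have h1 := h (s.map (Equiv.prodComm _ _).toEmbedding) ?_ (-μ)
  · rw [Finset.sum_filter, Finset.sum_map] at h1
    rw [Finset.sum_filter]
    refine le_of_eq_of_le (Finset.sum_congr rfl fun ξ _ => ?_) h1
    have e1 : |phase θ ξ.swap - -μ| = |phase θ ξ - μ| := by
      rw [phase_swap, ← abs_neg]; congr 1; ring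
    have e2 : bracketSymbol α (GrossPitaevskii.lossFreq j ξ) =
      bracketSymbol α (gainFreq j ξ.swap) := bracketSymbol_swap _ _
    simp only [Equiv.coe_toEmbedding, Equiv.prodComm_apply, e1, e2, bracketSymbol_swap]
  · intro x hx y hy
    obtain ⟨x', hx', rfl⟩ := Finset.mem_map.1 hx
    obtain ⟨y', hy', rfl⟩ := Finset.mem_map.1 hy
    exact Prod.swap_injective (hs x' hx' y' hy')

/-! ### Estimates for trigonometric polynomials and time slices -/

section FiniteSums
variable {d k : ℕ} {X : Type*} {ρ : X → Freq d k} {W : X → ℝ}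

/-- The trace estimate for trigonometric polynomials, by the Cauchy-Schwarz inequality in every
fiber of the frequency map. -/
theorem TraceBound.lintegral_le {C : ℝ} (h : TraceBound ρ W C) (hW : ∀ x, 0 < W x)
    (F : Finset X) (a : X → ℂ) :
    ∫⁻ z, ‖∑ x ∈ F, a x * character (ρ x) z‖ₑ ^ 2 ≤
      ENNReal.ofReal (configMass d k * (C * ∑ x ∈ F, W x ^ 2 * ‖a x‖ ^ 2)) := by
  classical
  rw [lintegral_enorm_sq_sum_character, ENNReal.ofReal_mul (configMass_pos d k).le]
  gcongr
  have hfib : ∀ η ∈ F.image ρ, ‖∑ x ∈ F with ρ x = η, a x‖ ^ 2 ≤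
      C * ∑ x ∈ F with ρ x = η, W x ^ 2 * ‖a x‖ ^ 2 := by
    intro η _
    have hs := h (F.filter fun x => ρ x = η) fun x hx y hy => by
      rw [(Finset.mem_filter.1 hx).2, (Finset.mem_filter.1 hy).2]
    calc ‖∑ x ∈ F with ρ x = η, a x‖ ^ 2
        ≤ (∑ x ∈ F with ρ x = η, (W x)⁻¹ * (W x * ‖a x‖)) ^ 2 := by
          gcongr
          refine (norm_sum_le _ _).trans (Finset.sum_le_sum fun x _ => ?_)
          rw [inv_mul_cancel_left₀ (hW x).ne']
      _ ≤ (∑ x ∈ F with ρ x = η, (W x)⁻¹ ^ 2) * ∑ x ∈ F with ρ x = η, (W x * ‖a x‖) ^ 2 :=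
          Finset.sum_mul_sq_le_sq_mul_sq _ _ _
      _ ≤ C * ∑ x ∈ F with ρ x = η, W x ^ 2 * ‖a x‖ ^ 2 := by
          simp only [mul_pow, inv_pow]
          exact mul_le_mul_of_nonneg_right hs (Finset.sum_nonneg fun _ _ => by positivity)
  calc ∑ η ∈ F.image ρ, ‖∑ x ∈ F with ρ x = η, a x‖ₑ ^ 2
      = ENNReal.ofReal (∑ η ∈ F.image ρ, ‖∑ x ∈ F with ρ x = η, a x‖ ^ 2) := by
        rw [ENNReal.ofReal_sum_of_nonneg fun _ _ => sq_nonneg _]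
        refine Finset.sum_congr rfl fun η _ => ?_
        rw [ENNReal.ofReal_pow (norm_nonneg _), ofReal_norm]
    _ ≤ _ := by
        refine ENNReal.ofReal_le_ofReal ((Finset.sum_le_sum hfib).trans (le_of_eq ?_))
        rw [← Finset.mul_sum,
          Finset.sum_fiberwise_of_maps_to (fun x hx => Finset.mem_image_of_mem ρ hx)]

/-- The space-time estimate for trigonometric polynomials, by the mean value estimate for
exponential sums in every fiber of the frequency map. -/
theorem ResonanceBound.lintegral_le {C : ℝ} {ω : X → ℝ} {v : Freq d k → ℝ}
    (h : ResonanceBound ρ ω W v C) (hW : ∀ x, 0 < W x) (hv : ∀ η, 0 < v η)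
    (F : Finset X) (a : X → ℂ) :
    ∫⁻ t in Set.Icc (0 : ℝ) 1, ∫⁻ z, ‖∑ x ∈ F,
        (v (ρ x) * a x * Complex.exp (-Complex.I * t * ω x)) * character (ρ x) z‖ₑ ^ 2 ≤
      ENNReal.ofReal (configMass d k * (meanValueConst * C * ∑ x ∈ F, W x ^ 2 * ‖a x‖ ^ 2)) := by
  classical
  simp only [lintegral_enorm_sq_sum_character]
  rw [lintegral_const_mul' _ _ ENNReal.ofReal_ne_top, ENNReal.ofReal_mul (configMass_pos d k).le]
  gcongr
  rw [lintegral_finsetSum]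
  swap
  · intro η _
    refine Measurable.pow_const (Measurable.enorm ?_) 2
    exact (continuous_finsetSum _ fun x _ => by fun_prop).measurable
  have hfib : ∀ η ∈ F.image ρ, ∫⁻ t in Set.Icc (0 : ℝ) 1, ‖∑ x ∈ F with ρ x = η,
      v (ρ x) * a x * Complex.exp (-Complex.I * t * ω x)‖ₑ ^ 2 ≤
      ENNReal.ofReal (meanValueConst * C * ∑ x ∈ F with ρ x = η, W x ^ 2 * ‖a x‖ ^ 2) := by
    intro η _
    have hs := h (F.filter fun x => ρ x = η) fun x hx y hy => by
      rw [(Finset.mem_filter.1 hx).2, (Finset.mem_filter.1 hy).2]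
    refine (lintegral_enorm_sq_exp_sum_le (F.filter fun x => ρ x = η)
      (fun x => v (ρ x) * a x) (w := fun x => v (ρ x) ^ 2 / W x ^ 2)
      (fun x => div_pos (pow_pos (hv _) 2) (pow_pos (hW x) 2)) hs).trans (le_of_eq ?_)
    congr 2
    refine Finset.sum_congr rfl fun x _ => ?_
    have h1 := (hv (ρ x)).ne'
    have h2 := (hW x).ne'
    rw [norm_mul, Complex.norm_real, mul_pow, Real.norm_eq_abs, sq_abs]
    field_simp
  have hC : 0 ≤ C := by
    have := h ∅ (by simp) 0
    simpa using this
  refine (Finset.sum_le_sum hfib).trans ?_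
  rw [← ENNReal.ofReal_sum_of_nonneg fun η _ => mul_nonneg (mul_nonneg meanValueConst_nonneg hC)
    (Finset.sum_nonneg fun _ _ => by positivity), ← Finset.mul_sum,
    Finset.sum_fiberwise_of_maps_to (fun x hx => Finset.mem_image_of_mem ρ hx)]

theorem enorm_sub_sq_le (a b : ℂ) : ‖a - b‖ₑ ^ 2 ≤ 2 * (‖a‖ₑ ^ 2 + ‖b‖ₑ ^ 2) := by
  have h : ‖a - b‖ ^ 2 ≤ 2 * (‖a‖ ^ 2 + ‖b‖ ^ 2) := by
    have h1 := norm_sub_le a b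
    have h2 : ‖a - b‖ ^ 2 ≤ (‖a‖ + ‖b‖) ^ 2 := by gcongr
    nlinarith [sq_nonneg (‖a‖ - ‖b‖)]
  have h3 := ENNReal.ofReal_le_ofReal h
  rwa [ENNReal.ofReal_mul (by norm_num), ENNReal.ofReal_add (by positivity) (by positivity),
    ENNReal.ofReal_pow (norm_nonneg _), ENNReal.ofReal_pow (norm_nonneg _),
    ENNReal.ofReal_pow (norm_nonneg _), ofReal_norm, ofReal_norm, ofReal_norm,
    ENNReal.ofReal_ofNat] at h3

theorem lintegral_enorm_sub_sq_le {Ω : Type*} [MeasurableSpace Ω] {μ : Measure Ω}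
    {f g : Ω → ℂ} (hf : Measurable f) {A B : ℝ} (hA : 0 ≤ A) (hB : 0 ≤ B)
    (h1 : ∫⁻ z, ‖f z‖ₑ ^ 2 ∂μ ≤ ENNReal.ofReal A) (h2 : ∫⁻ z, ‖g z‖ₑ ^ 2 ∂μ ≤ ENNReal.ofReal B) :
    ∫⁻ z, ‖f z - g z‖ₑ ^ 2 ∂μ ≤ ENNReal.ofReal (2 * (A + B)) := by
  calc ∫⁻ z, ‖f z - g z‖ₑ ^ 2 ∂μ ≤ ∫⁻ z, 2 * (‖f z‖ₑ ^ 2 + ‖g z‖ₑ ^ 2) ∂μ :=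
        lintegral_mono fun z => enorm_sub_sq_le _ _
    _ = 2 * (∫⁻ z, ‖f z‖ₑ ^ 2 ∂μ + ∫⁻ z, ‖g z‖ₑ ^ 2 ∂μ) := by
        rw [lintegral_const_mul' _ _ (by norm_num),
          lintegral_add_left (hf.enorm.pow_const 2)]
    _ ≤ 2 * (ENNReal.ofReal A + ENNReal.ofReal B) := by gcongr
    _ = _ := by
        rw [ENNReal.ofReal_mul (by norm_num), ENNReal.ofReal_add hA hB, ENNReal.ofReal_ofNat]

end FiniteSums

section Slices
variable {d k : ℕ}

/-- The Riesz-Fischer theorem. -/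
theorem exists_fourierTransform_eq {c : Freq d k → ℂ} (hc : Summable fun ξ => ‖c ξ‖ ^ 2) :
    ∃ u : Config d k → ℂ, MemLp u 2 volume ∧ ∀ ξ, fourierTransform u ξ = c ξ := by
  classical
  have hV := configMass_pos d k
  have hVc : (configMass d k : ℂ) ≠ 0 := by exact_mod_cast hV.ne'
  obtain ⟨u, hu, hlim, -⟩ := exists_tendsto_eLpNorm_sum_sub (μ := volume)
    (f := fun ξ x => ((configMass d k : ℂ)⁻¹ * c ξ) * character ξ x)
    (fun ξ => (memLp_character ξ 2).const_mul _)
    (g := fun ξ => configMass d k * ‖(configMass d k : ℂ)⁻¹ * c ξ‖ ^ 2) (fun ξ => by positivity)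
    (by simpa only [norm_mul, mul_pow] using (hc.mul_left _).mul_left _) (fun F => by
      rw [eLpNorm_two_sq]
      have hid : TraceBound (fun ξ : Freq d k => ξ) (fun _ => (1 : ℝ)) 1 := fun s hs => by
        simpa using Finset.card_le_one.2 hs
      refine (hid.lintegral_le (fun _ => one_pos) F _).trans (le_of_eq ?_)
      simp [Finset.mul_sum])
  refine ⟨u, hu, fun η => ?_⟩
  have h1 := tendsto_fourierTransform (fun F : Finset (Freq d k) =>
    memLp_sum_character F (fun ξ => (configMass d k : ℂ)⁻¹ * c ξ) id 2) hu hlim η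
  refine tendsto_nhds_unique h1 ?_
  refine tendsto_const_nhds.congr' ?_
  filter_upwards [eventually_ge_atTop {η}] with F hF
  have hη : F.filter (fun i => id i = η) = {η} := by
    ext i
    simp only [Finset.mem_filter, Finset.mem_singleton, id]
    exact ⟨fun h => h.2, fun h => ⟨by rw [h]; exact hF (Finset.mem_singleton_self η), h⟩⟩
  rw [fourierTransform_sum_character F _ id η, hη, Finset.sum_singleton,
    mul_inv_cancel_left₀ hVc]

theorem ae_memLp_slice {G : ℝ × Config d k → ℂ} (hG : MemLp G 2 (spacetimeMeasure d k)) :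
    ∀ᵐ t ∂(volume.restrict (Set.Icc (0 : ℝ) 1)), MemLp (fun x => G (t, x)) 2 volume := by
  have h1 : ∀ᵐ t ∂(volume.restrict (Set.Icc (0 : ℝ) 1)),
      AEStronglyMeasurable (fun x => G (t, x)) volume := hG.1.prodMk_left
  have h2 : ∫⁻ t in Set.Icc (0 : ℝ) 1, ∫⁻ x, ‖G (t, x)‖ₑ ^ 2 ≠ ⊤ := by
    rw [← lintegral_prod (fun p : ℝ × Config d k => ‖G p‖ₑ ^ 2) (hG.1.enorm.pow_const 2)]
    change ∫⁻ p, ‖G p‖ₑ ^ 2 ∂(spacetimeMeasure d k) ≠ ⊤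
    rw [← eLpNorm_two_sq]
    exact ENNReal.pow_ne_top hG.2.ne
  filter_upwards [h1, ae_lt_top' (hG.1.enorm.pow_const 2).lintegral_prod_right' h2]
    with t ht1 ht2
  refine ⟨ht1, ?_⟩
  rw [← eLpNorm_two_sq] at ht2
  by_contra h
  rw [not_lt, top_le_iff] at h
  rw [h] at ht2
  simp at ht2

/-- If `S n → G` in `L²` of space-time and the Fourier coefficients of the time slices of `S n`
converge pointwise in time, then the limits are almost everywhere the Fourier coefficients of the
time slices of `G`. -/
theorem ae_fourierTransform_slice_eq {G : ℝ × Config d k → ℂ}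
    (hG : MemLp G 2 (spacetimeMeasure d k)) {S : ℕ → ℝ × Config d k → ℂ}
    (hS : ∀ n, MemLp (S n) 2 (spacetimeMeasure d k))
    (hSt : ∀ n t, MemLp (fun x => S n (t, x)) 2 volume)
    (hlim : Tendsto (fun n => eLpNorm (fun p => S n p - G p) 2 (spacetimeMeasure d k)) atTop (𝓝 0))
    {η : Freq d k} {l : ℝ → ℂ}
    (hl : ∀ t, Tendsto (fun n => fourierTransform (fun x => S n (t, x)) η) atTop (𝓝 (l t))) :
    ∀ᵐ t ∂(volume.restrict (Set.Icc (0 : ℝ) 1)),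
      fourierTransform (fun x => G (t, x)) η = l t := by
  set e : ℕ → ℝ → ℝ≥0∞ := fun n t =>
    ENNReal.ofReal (configMass d k) * ∫⁻ x, ‖S n (t, x) - G (t, x)‖ₑ ^ 2 with he
  have hmeas : ∀ n, AEMeasurable (fun p => ‖S n p - G p‖ₑ ^ 2) (spacetimeMeasure d k) := fun n =>
    ((hS n).1.sub hG.1).enorm.pow_const 2
  have hint : ∀ n, ∫⁻ t in Set.Icc (0 : ℝ) 1, e n t = ENNReal.ofReal (configMass d k) *
      eLpNorm (fun p => S n p - G p) 2 (spacetimeMeasure d k) ^ 2 := by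
    intro n
    simp only [he]
    rw [lintegral_const_mul' _ _ ENNReal.ofReal_ne_top, eLpNorm_two_sq, spacetimeMeasure,
      lintegral_prod _ (hmeas n)]
  have hint0 : Tendsto (fun n => ∫⁻ t in Set.Icc (0 : ℝ) 1, e n t) atTop (𝓝 0) := by
    simp only [hint]
    have := ENNReal.Tendsto.const_mul (a := ENNReal.ofReal (configMass d k))
      (((ENNReal.continuous_pow 2).tendsto 0).comp hlim) (Or.inr ENNReal.ofReal_ne_top)
    simpa using this
  have hemeas : ∀ n, AEMeasurable (e n) (volume.restrict (Set.Icc (0 : ℝ) 1)) := fun n =>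
    (hmeas n).lintegral_prod_right'.const_mul _
  have hfatou : ∫⁻ t in Set.Icc (0 : ℝ) 1, liminf (fun n => e n t) atTop = 0 := by
    have h1 := lintegral_liminf_le' (u := atTop) hemeas
    have h2 := hint0.liminf_eq
    rw [h2] at h1
    exact le_antisymm h1 zero_le
  have hliminf : AEMeasurable (fun t => liminf (fun n => e n t) atTop)
      (volume.restrict (Set.Icc (0 : ℝ) 1)) := by
    refine (Measurable.liminf fun n => (hemeas n).measurable_mk).aemeasurable.congr ?_
    filter_upwards [ae_all_iff.2 fun n => (hemeas n).ae_eq_mk] with t ht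
    simp only [← ht]
  have hzero := (lintegral_eq_zero_iff' hliminf).1 hfatou
  filter_upwards [hzero, ae_memLp_slice hG] with t ht hGt
  have h1 : Tendsto (fun n => ‖fourierTransform (fun x => S n (t, x)) η -
      fourierTransform (fun x => G (t, x)) η‖ₑ ^ 2) atTop
      (𝓝 (‖l t - fourierTransform (fun x => G (t, x)) η‖ₑ ^ 2)) :=
    ((ENNReal.continuous_pow 2).tendsto _).comp (((hl t).sub_const _).enorm)
  have h2 : ∀ n, ‖fourierTransform (fun x => S n (t, x)) η -
      fourierTransform (fun x => G (t, x)) η‖ₑ ^ 2 ≤ e n t := by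
    intro n
    rw [← fourierTransform_sub (hSt n t) hGt]
    refine (enorm_sq_fourierTransform_le ((hSt n t).sub hGt) η).trans (le_of_eq ?_)
    rw [eLpNorm_two_sq]
    rfl
  have h3 : ‖l t - fourierTransform (fun x => G (t, x)) η‖ₑ ^ 2 ≤ 0 := by
    rw [← h1.liminf_eq]
    refine (liminf_le_liminf (Eventually.of_forall h2)).trans (le_of_eq ?_)
    exact ht
  have h4 : ‖l t - fourierTransform (fun x => G (t, x)) η‖ₑ = 0 := by
    simpa using h3
  exact (sub_eq_zero.1 (enorm_eq_zero.1 h4)).symm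

end Slices

/-! ### The collision estimate -/

section Estimate
variable {d k : ℕ}

instance : BorelSpace (Fin k → Torus d) := Pi.borelSpace

instance : IsFiniteMeasure (spacetimeMeasure d k) := by
  unfold spacetimeMeasure; infer_instance

theorem norm_exp_neg_I_mul (t s : ℝ) : ‖Complex.exp (-Complex.I * t * s)‖ = 1 := by
  have : -Complex.I * t * s = ((-(t * s) : ℝ) : ℂ) * Complex.I := by push_cast; ring
  rw [this, Complex.norm_exp_ofReal_mul_I]

open scoped Classical in
theorem fourierTransform_sum_sub {X : Type*} (F : Finset X) (c c' : X → ℂ)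
    (ρ ρ' : X → Freq d k) (η : Freq d k) :
    fourierTransform (fun z => ∑ x ∈ F, (c x * character (ρ x) z - c' x * character (ρ' x) z)) η =
      configMass d k * (∑ x ∈ F with ρ x = η, c x - ∑ x ∈ F with ρ' x = η, c' x) := by
  simp only [Finset.sum_sub_distrib]
  rw [fourierTransform_sub (memLp_sum_character F c ρ 2) (memLp_sum_character F c' ρ' 2),
    fourierTransform_sum_character, fourierTransform_sum_character, mul_sub]

/-- Differences of two trigonometric polynomials with frequency maps `ρ` and `ρ'` which
satisfy the trace bound. -/
theorem eLpNorm_sum_sub_sq_le {X : Type*} {ρ ρ' : X → Freq d k} {W : X → ℝ} {C : ℝ}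
    (h : TraceBound ρ W C) (h' : TraceBound ρ' W C) (hC : 0 ≤ C) (hW : ∀ x, 0 < W x)
    (F : Finset X) (c : X → ℂ) :
    eLpNorm (fun z => ∑ x ∈ F, (c x * character (ρ x) z - c x * character (ρ' x) z)) 2 volume ^ 2 ≤
      ENNReal.ofReal (∑ x ∈ F, 4 * configMass d k * C * (W x ^ 2 * ‖c x‖ ^ 2)) := by
  have hV := configMass_pos d k
  have h0 : 0 ≤ configMass d k * (C * ∑ x ∈ F, W x ^ 2 * ‖c x‖ ^ 2) :=
    mul_nonneg hV.le (mul_nonneg hC (Finset.sum_nonneg fun _ _ => by positivity))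
  simp only [eLpNorm_two_sq, Finset.sum_sub_distrib]
  refine (lintegral_enorm_sub_sq_le ?_ h0 h0 (h.lintegral_le hW F c)
    (h'.lintegral_le hW F c)).trans (le_of_eq ?_)
  · exact (continuous_finsetSum _ fun x _ =>
      continuous_const.mul (continuous_character (ρ x))).measurable
  · rw [← Finset.mul_sum]; congr 1; ring

/-- The space-time function with frequencies `ρ x` in space and `ω x` in time, amplitude `a x`, and
weight `v` at its spatial frequency. -/
noncomputable def wave {X : Type*} (ρ : X → Freq d k) (ω : X → ℝ) (v : Freq d k → ℝ) (a : X → ℂ)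
    (x : X) (p : ℝ × Config d k) : ℂ :=
  v (ρ x) * a x * Complex.exp (-Complex.I * p.1 * ω x) * character (ρ x) p.2

theorem continuous_wave {X : Type*} (ρ : X → Freq d k) (ω : X → ℝ) (v : Freq d k → ℝ) (a : X → ℂ)
    (x : X) : Continuous (wave ρ ω v a x) := by
  have := continuous_character (ρ x)
  unfold wave
  fun_prop

theorem memLp_wave {X : Type*} (ρ : X → Freq d k) (ω : X → ℝ) (v : Freq d k → ℝ) (a : X → ℂ)
    (x : X) : MemLp (wave ρ ω v a x) 2 (spacetimeMeasure d k) := by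
  refine MemLp.of_bound (continuous_wave ρ ω v a x).aestronglyMeasurable ‖v (ρ x) * a x‖
    (Eventually.of_forall fun p => ?_)
  rw [wave, norm_mul, norm_character, norm_mul, norm_exp_neg_I_mul, mul_one, mul_one]

theorem memLp_wave_slice {X : Type*} (ρ : X → Freq d k) (ω : X → ℝ) (v : Freq d k → ℝ) (a : X → ℂ)
    (x : X) (t : ℝ) : MemLp (fun z => wave ρ ω v a x (t, z)) 2 volume :=
  (memLp_character (ρ x) 2).const_mul (v (ρ x) * a x * Complex.exp (-Complex.I * t * ω x))

theorem eLpNorm_sum_wave_sub_sq_le {X : Type*} {ρ ρ' : X → Freq d k} {ω W : X → ℝ}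
    {v : Freq d k → ℝ} {C : ℝ} (h : ResonanceBound ρ ω W v C) (h' : ResonanceBound ρ' ω W v C)
    (hC : 0 ≤ C) (hW : ∀ x, 0 < W x) (hv : ∀ η, 0 < v η) (F : Finset X) (a : X → ℂ) :
    eLpNorm (fun p => ∑ x ∈ F, (wave ρ ω v a x p - wave ρ' ω v a x p)) 2
        (spacetimeMeasure d k) ^ 2 ≤
      ENNReal.ofReal (∑ x ∈ F,
        4 * configMass d k * (meanValueConst * C) * (W x ^ 2 * ‖a x‖ ^ 2)) := by
  have hV := configMass_pos d k
  have h0 : 0 ≤ configMass d k * (meanValueConst * C * ∑ x ∈ F, W x ^ 2 * ‖a x‖ ^ 2) :=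
    mul_nonneg hV.le (mul_nonneg (mul_nonneg meanValueConst_nonneg hC)
      (Finset.sum_nonneg fun _ _ => by positivity))
  have hcont : ∀ σ : X → Freq d k, Continuous fun p => ∑ x ∈ F, wave σ ω v a x p := fun σ =>
    continuous_finsetSum _ fun x _ => continuous_wave σ ω v a x
  have hint : ∀ σ : X → Freq d k, ResonanceBound σ ω W v C →
      ∫⁻ p, ‖∑ x ∈ F, wave σ ω v a x p‖ₑ ^ 2 ∂(spacetimeMeasure d k) ≤
        ENNReal.ofReal (configMass d k * (meanValueConst * C * ∑ x ∈ F, W x ^ 2 * ‖a x‖ ^ 2)) := by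
    intro σ hσ
    rw [spacetimeMeasure, lintegral_prod _ ((hcont σ).measurable.enorm.pow_const 2).aemeasurable]
    exact hσ.lintegral_le hW hv F a
  simp only [eLpNorm_two_sq, Finset.sum_sub_distrib]
  refine (lintegral_enorm_sub_sq_le (hcont ρ).measurable h0 h0 (hint ρ h)
    (hint ρ' h')).trans (le_of_eq ?_)
  rw [← Finset.mul_sum]; congr 1; ring

/-- The collision estimate at a fixed order `k`, given the two bounds of the lattice sums over the
fibers of the frequency map of the collision operator. -/
theorem exists_collision_estimate {α : ℝ} {θ : Fin d → ℝ} {j : Fin k}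
    {C₁ C₂ : ℝ} (hC₁ : 0 ≤ C₁) (hC₂ : 0 ≤ C₂)
    (hT : TraceBound (gainFreq (d := d) j) (bracketSymbol α) C₁)
    (hR : ResonanceBound (gainFreq (d := d) j) (phase θ) (bracketSymbol α) (bracketSymbol α) C₂)
    {γ₀ Sγ₀ : Config d (k + 1) → ℂ} (h : IsFracDeriv α γ₀ Sγ₀) :
    ∃ G : ℝ × Config d k → ℂ, MemLp G 2 (spacetimeMeasure d k) ∧
      (∀ᵐ t ∂(volume.restrict (Set.Icc (0 : ℝ) 1)),
        ∃ (u : Config d (k + 1) → ℂ) (b : Config d k → ℂ),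
          IsFreeEvolution θ t γ₀ u ∧ IsCollision j u b ∧ IsFracDeriv α b (fun x => G (t, x))) ∧
      eLpNorm G 2 (spacetimeMeasure d k) ^ 2 ≤
        ENNReal.ofReal (4 * (meanValueConst * C₂)) * eLpNorm Sγ₀ 2 volume ^ 2 := by
  classical
  obtain ⟨hγ₀, hS, hmul⟩ := h
  have hmul' : ∀ ξ, fourierTransform Sγ₀ ξ = bracketSymbol α ξ * fourierTransform γ₀ ξ := hmul
  set V₁ := configMass d (k + 1) with hV₁
  set V₀ := configMass d k with hV₀
  have hV₁pos : 0 < V₁ := configMass_pos d (k + 1)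
  have hV₀pos : 0 < V₀ := configMass_pos d k
  have hV : V₀ ≤ V₁ := by
    have h2π : 1 ≤ 2 * π := by linarith [Real.pi_gt_three]
    exact pow_le_pow_right₀ h2π (Nat.mul_le_mul_left _ (Nat.le_succ k))
  have hW : ∀ ξ : Freq d (k + 1), 0 < bracketSymbol α ξ := bracketSymbol_pos α
  let a : Freq d (k + 1) → ℂ := fun ξ => (V₁ : ℂ)⁻¹ * fourierTransform γ₀ ξ
  let E : ℝ → Freq d (k + 1) → ℂ := fun t ξ => Complex.exp (-Complex.I * t * phase θ ξ)
  have hE : ∀ t ξ, ‖E t ξ‖ = 1 := fun t ξ => norm_exp_neg_I_mul t _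
  -- The weighted `ℓ²` norm of the Fourier coefficients.
  have hWa : ∀ ξ, bracketSymbol α ξ ^ 2 * ‖a ξ‖ ^ 2 =
      (V₁⁻¹) ^ 2 * ‖fourierTransform Sγ₀ ξ‖ ^ 2 := by
    intro ξ
    rw [hmul', norm_mul, norm_mul, norm_inv, Complex.norm_real, Complex.norm_real,
      Real.norm_eq_abs, Real.norm_eq_abs, abs_of_pos hV₁pos, abs_of_pos (hW ξ)]
    ring
  have hsum : Summable fun ξ => bracketSymbol α ξ ^ 2 * ‖a ξ‖ ^ 2 := by
    simp only [hWa]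
    exact (summable_norm_sq_fourierTransform hS).mul_left _
  have htsum : ∑' ξ, bracketSymbol α ξ ^ 2 * ‖a ξ‖ ^ 2 ≤
      V₁⁻¹ * (eLpNorm Sγ₀ 2 volume).toReal ^ 2 := by
    simp only [hWa]
    rw [tsum_mul_left]
    refine (mul_le_mul_of_nonneg_left (tsum_norm_sq_fourierTransform_le hS)
      (sq_nonneg _)).trans (le_of_eq ?_)
    rw [← hV₁]
    field_simp
  -- The free evolution.
  have hu : ∀ t : ℝ, ∃ u : Config d (k + 1) → ℂ, MemLp u 2 volume ∧
      ∀ ξ, fourierTransform u ξ = E t ξ * fourierTransform γ₀ ξ := by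
    intro t
    refine exists_fourierTransform_eq ?_
    simp only [norm_mul, hE, one_mul]
    exact summable_norm_sq_fourierTransform hγ₀
  choose u hu hufreq using hu
  -- The collision operator applied to the free evolution.
  let f : ℝ → Freq d (k + 1) → Config d k → ℂ := fun t ξ x =>
    a ξ * E t ξ * character (gainFreq j ξ) x - a ξ * E t ξ * character (lossFreq j ξ) x
  have hfmem : ∀ t ξ, MemLp (f t ξ) 2 volume := fun t ξ =>
    ((memLp_character _ 2).const_mul _).sub ((memLp_character _ 2).const_mul _)
  have hb : ∀ t : ℝ, ∃ b : Config d k → ℂ, MemLp b 2 volume ∧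
      Tendsto (fun F : Finset (Freq d (k + 1)) =>
        eLpNorm (fun z => ∑ ξ ∈ F, f t ξ z - b z) 2 volume) atTop (𝓝 0) := by
    intro t
    obtain ⟨b, h1, h2, -⟩ := exists_tendsto_eLpNorm_sum_sub (hfmem t)
      (g := fun ξ => 4 * V₀ * C₁ * (bracketSymbol α ξ ^ 2 * ‖a ξ * E t ξ‖ ^ 2))
      (fun ξ => by positivity)
      (by simpa only [norm_mul, hE, mul_one] using hsum.mul_left (4 * V₀ * C₁))
      (fun F => eLpNorm_sum_sub_sq_le hT hT.lossFreq hC₁ hW F fun ξ => a ξ * E t ξ)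
    exact ⟨b, h1, h2⟩
  choose b hb hblim using hb
  have hcoll : ∀ t, IsCollision j (u t) (b t) := by
    intro t
    refine ⟨hu t, hb t, (hblim t).congr fun F => ?_⟩
    congr 1
    funext x
    congr 1
    have h1 : partialSum F (u t) = fun y => ∑ ξ ∈ F, (a ξ * E t ξ) * character ξ y := by
      funext y
      rw [partialSum, Finset.mul_sum]
      refine Finset.sum_congr rfl fun ξ _ => ?_
      rw [hufreq]
      simp only [a, hV₁, configMass]
      ring
    rw [h1, collision_sum_character j F (fun ξ => a ξ * E t ξ) fun ξ => ξ]
  -- The weighted space-time function.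
  let w : Freq d (k + 1) → ℝ × Config d k → ℂ := fun ξ p =>
    wave (gainFreq j) (phase θ) (bracketSymbol α) a ξ p -
      wave (lossFreq j) (phase θ) (bracketSymbol α) a ξ p
  have hwmem : ∀ ξ, MemLp (w ξ) 2 (spacetimeMeasure d k) := fun ξ =>
    (memLp_wave _ _ _ _ _).sub (memLp_wave _ _ _ _ _)
  have hM := meanValueConst_nonneg
  obtain ⟨G, hG, hGlim, hGle⟩ := exists_tendsto_eLpNorm_sum_sub hwmem
    (g := fun ξ => 4 * V₀ * (meanValueConst * C₂) * (bracketSymbol α ξ ^ 2 * ‖a ξ‖ ^ 2))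
    (fun ξ => by positivity) (hsum.mul_left _)
    (fun F => eLpNorm_sum_wave_sub_sq_le hR hR.lossFreq hC₂ hW (bracketSymbol_pos α) F a)
  refine ⟨G, hG, ?_, ?_⟩
  · -- Fatou's lemma is applied along a sequence of finite sets which exhausts the frequencies.
    obtain ⟨F, hF⟩ := exists_seq_tendsto (atTop : Filter (Finset (Freq d (k + 1))))
    have hslice : ∀ (s : Finset (Freq d (k + 1))) (t : ℝ) (η : Freq d k),
        fourierTransform (fun x => ∑ ξ ∈ s, w ξ (t, x)) η =
          bracketSymbol α η * fourierTransform (fun x => ∑ ξ ∈ s, f t ξ x) η := by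
      intro s t η
      simp only [w, f, wave]
      rw [fourierTransform_sum_sub s (fun ξ => bracketSymbol α (gainFreq j ξ) * a ξ * E t ξ)
        (fun ξ => bracketSymbol α (lossFreq j ξ) * a ξ * E t ξ),
        fourierTransform_sum_sub s (fun ξ => a ξ * E t ξ) (fun ξ => a ξ * E t ξ)]
      have h1 : ∀ σ : Freq d (k + 1) → Freq d k,
          ∑ ξ ∈ s with σ ξ = η, (bracketSymbol α (σ ξ) * a ξ * E t ξ : ℂ) =
            bracketSymbol α η * ∑ ξ ∈ s with σ ξ = η, a ξ * E t ξ := by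
        intro σ
        rw [Finset.mul_sum]
        refine Finset.sum_congr rfl fun ξ hξ => ?_
        rw [(Finset.mem_filter.1 hξ).2, mul_assoc]
      rw [h1, h1]
      ring
    have hall : ∀ᵐ t ∂(volume.restrict (Set.Icc (0 : ℝ) 1)), ∀ η : Freq d k,
        fourierTransform (fun x => G (t, x)) η =
          bracketSymbol α η * fourierTransform (b t) η := by
      rw [ae_all_iff]
      intro η
      refine ae_fourierTransform_slice_eq hG (S := fun n p => ∑ ξ ∈ F n, w ξ p)
        (fun n => memLp_finsetSum _ fun ξ _ => hwmem ξ) (fun n t => ?_) (hGlim.comp hF)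
        fun t => ?_
      · refine memLp_finsetSum _ fun ξ _ => ?_
        exact (memLp_wave_slice (gainFreq j) (phase θ) (bracketSymbol α) a ξ t).sub
          (memLp_wave_slice (lossFreq j) (phase θ) (bracketSymbol α) a ξ t)
      · simp only [hslice]
        exact (tendsto_fourierTransform
          (fun n => memLp_finsetSum (F n) fun ξ _ => hfmem t ξ) (hb t)
          ((hblim t).comp hF) η).const_mul _
    filter_upwards [hall, ae_memLp_slice hG] with t ht hGt
    exact ⟨u t, b t, ⟨hγ₀, hu t, hufreq t⟩, hcoll t, hb t, hGt, ht⟩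
  · refine hGle.trans ?_
    rw [← ENNReal.ofReal_toReal hS.2.ne, ← ENNReal.ofReal_pow ENNReal.toReal_nonneg,
      ← ENNReal.ofReal_mul (by positivity), tsum_mul_left]
    refine ENNReal.ofReal_le_ofReal ?_
    -- The quotient of the two masses is at most `1`, so the constant does not depend on `k`.
    have hratio : V₀ * V₁⁻¹ ≤ 1 := by
      rw [← div_eq_mul_inv]; exact (div_le_one hV₁pos).2 hV
    calc 4 * V₀ * (meanValueConst * C₂) * ∑' ξ, bracketSymbol α ξ ^ 2 * ‖a ξ‖ ^ 2
        ≤ 4 * V₀ * (meanValueConst * C₂) * (V₁⁻¹ * (eLpNorm Sγ₀ 2 volume).toReal ^ 2) := by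
          gcongr
      _ = (V₀ * V₁⁻¹) * (4 * (meanValueConst * C₂) * (eLpNorm Sγ₀ 2 volume).toReal ^ 2) := by ring
      _ ≤ _ := mul_le_of_le_one_left (by positivity) hratio

end Estimate

end GrossPitaevskii

open GrossPitaevskii in
theorem proposition4p1 (α : ℝ) (hα : 1 < α) (θ : Fin 3 → ℝ) (hθ : ∀ a, 0 < θ a) :
    ∃ C : ℝ, 0 < C ∧
      ∀ (k : ℕ) (j : Fin k) (γ₀ Sγ₀ : GrossPitaevskii.Config 3 (k + 1) → ℂ),
        GrossPitaevskii.IsFracDeriv α γ₀ Sγ₀ →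
        ∃ G : ℝ × GrossPitaevskii.Config 3 k → ℂ,
          MemLp G 2 (GrossPitaevskii.spacetimeMeasure 3 k) ∧
          (∀ᵐ t ∂(volume.restrict (Set.Icc (0 : ℝ) 1)),
            ∃ (u : GrossPitaevskii.Config 3 (k + 1) → ℂ) (b : GrossPitaevskii.Config 3 k → ℂ),
              GrossPitaevskii.IsFreeEvolution θ t γ₀ u ∧
              GrossPitaevskii.IsCollision j u b ∧
              GrossPitaevskii.IsFracDeriv α b (fun x => G (t, x))) ∧
          eLpNorm G 2 (GrossPitaevskii.spacetimeMeasure 3 k) ≤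
            ENNReal.ofReal C * eLpNorm Sγ₀ 2 volume := by
  obtain ⟨C₁, hC₁, hT⟩ := exists_traceBound_gainFreq hα
  obtain ⟨C₂, hC₂, hR⟩ := exists_resonanceBound_gainFreq hα hθ
  have hM := meanValueConst_nonneg
  have hK : 0 ≤ 4 * (meanValueConst * C₂) := by positivity
  -- The summand `1` only serves to make the constant positive.
  refine ⟨√(4 * (meanValueConst * C₂)) + 1, by positivity, fun k j γ₀ Sγ₀ h => ?_⟩
  obtain ⟨G, hG, hae, hle⟩ := exists_collision_estimate hC₁ hC₂ (hT k j) (hR k j) h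
  refine ⟨G, hG, hae, ?_⟩
  have hsq : eLpNorm G 2 (spacetimeMeasure 3 k) ^ 2 ≤
      (ENNReal.ofReal √(4 * (meanValueConst * C₂)) * eLpNorm Sγ₀ 2 volume) ^ 2 := by
    rw [mul_pow, ← ENNReal.ofReal_pow (Real.sqrt_nonneg _), Real.sq_sqrt hK]
    exact hle
  refine ((ENNReal.pow_right_strictMono two_ne_zero).le_iff_le.1 hsq).trans ?_
  gcongr
  linarith
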